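/- Let $n\ge 1$, $C>0$ and $\rho>\tfrac14$. There is a constant $\lambda_0=\lambda_0(C,n,\rho)$ with the following property. Let $V\in L^\infty(\mathbb R\times\mathbb R^n;\mathbb C)$ and $W\in L^\infty(\mathbb R\times\mathbb R^n;\mathbb C\times\mathbb C^n)$ satisfy $$|V(t,x)|\le \frac{C}{(1+|x|^2)^{\rho}},\qquad |W(t,x)|\le \frac{C}{(1+|x|^2)^{\rho}}$$ for almost every $(t,x)\in\mathbb R\times\mathbb R^n$. Let $u:\mathbb R\times\mathbb R^n\to\mathbb C$ belong to $C^1(\mathbb R;H^1(\mathbb R^n))\cap H^2_{loc}(\mathbb R\times\mathbb R^n)$ and satisfy $$|(\partial_t^2+\Delta)u|\le |Vu|+|W\cdot(\partial_t,\nabla)u|\quad\text{a.e. in }\mathbb R^{n+1},$$ where $\Delta$ and $\nabla$ act in the variable $x$, derivatives are weak, and $W\cdot(\partial_t,\nabla)u=W^0\partial_tu+\sum_{j=1}^nW^j\partial_{x_j}u$. If $$\sup_{t\in\mathbb R}\int_{\mathbb R^n}e^{4\lambda|x|}|u(t,x)|^2\,dx<\infty$$ for some $\lambda>\lambda_0$,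 then $u\equiv0$. -/

import Mathlib

open MeasureTheory
open scoped ENNReal ContDiff

noncomputable section

namespace Waveguide

/-- The space `ℝⁿ` of the variable `x`, with its Euclidean norm. -/
abbrev Space (n : ℕ) : Type := EuclideanSpace ℝ (Fin n)

/-- The space-time `ℝ × ℝⁿ` of the variable `(t, x)`; its volume is the product Lebesgue measure. -/
abbrev SpaceTime (n : ℕ) : Type := ℝ × Space n

section WeakDerivatives

variable {F : Type*} [NormedAddCommGroup F] [NormedSpace ℝ F] [MeasureSpace F]

/-- `g` is the weak derivative of `f` in the direction `v`, tested against all smooth compactly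
supported functions. -/
structure HasWeakDeriv (v : F) (f g : F → ℂ) : Prop where
  locallyIntegrable : LocallyIntegrable f volume
  locallyIntegrable_deriv : LocallyIntegrable g volume
  integral_eq : ∀ φ : F → ℝ, ContDiff ℝ ∞ φ → HasCompactSupport φ →
    ∫ x, (fderiv ℝ φ x v) • f x = -∫ x, φ x • g x

open Classical in
/-- The weak derivative of `f` in the direction `v` (unique up to null sets), and `0` if there is
none. -/
def weakDeriv (v : F) (f : F → ℂ) : F → ℂ :=
  if h : ∃ g, HasWeakDeriv v f g then h.choose else 0

/-- `f ∈ L²_loc`. -/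
def MemL2loc (f : F → ℂ) : Prop :=
  ∀ K : Set F, IsCompact K → MemLp f 2 (volume.restrict K)

/-- `f ∈ H^k_loc`: `f` and all its weak derivatives of order at most `k` are in `L²_loc`. -/
def MemHloc : ℕ → (F → ℂ) → Prop
  | 0, f => MemL2loc f
  | k + 1, f => MemL2loc f ∧ ∀ v : F, ∃ g, HasWeakDeriv v f g ∧ MemHloc k g

theorem HasWeakDeriv.congr {v : F} {f f' g g' : F → ℂ} (h : HasWeakDeriv v f g)
    (hf : f' =ᵐ[volume] f) (hg : g' =ᵐ[volume] g) : HasWeakDeriv v f' g' where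
  locallyIntegrable := h.locallyIntegrable.congr hf.symm
  locallyIntegrable_deriv := h.locallyIntegrable_deriv.congr hg.symm
  integral_eq φ hφ hc := by
    have h1 : ∫ x, (fderiv ℝ φ x v) • f' x = ∫ x, (fderiv ℝ φ x v) • f x :=
      integral_congr_ae (by filter_upwards [hf] with x hx; rw [hx])
    have h2 : ∫ x, φ x • g' x = ∫ x, φ x • g x :=
      integral_congr_ae (by filter_upwards [hg] with x hx; rw [hx])
    rw [h1, h2]
    exact h.integral_eq φ hφ hc

theorem HasWeakDeriv.zero (v : F) : HasWeakDeriv v (0 : F → ℂ) 0 where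
  locallyIntegrable := locallyIntegrable_zero
  locallyIntegrable_deriv := locallyIntegrable_zero
  integral_eq φ _ _ := by simp

theorem HasWeakDeriv.const_smul {v : F} {f g : F → ℂ} (h : HasWeakDeriv v f g) (c : ℂ) :
    HasWeakDeriv v (c • f) (c • g) where
  locallyIntegrable := h.locallyIntegrable.smul c
  locallyIntegrable_deriv := h.locallyIntegrable_deriv.smul c
  integral_eq φ hφ hc := by
    simp only [Pi.smul_apply, smul_comm _ c, integral_smul]
    rw [h.integral_eq φ hφ hc, smul_neg]

theorem HasWeakDeriv.add [OpensMeasurableSpace F] {v : F} {f g f' g' : F → ℂ}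
    (h : HasWeakDeriv v f g) (h' : HasWeakDeriv v f' g') :
    HasWeakDeriv v (f + f') (g + g') where
  locallyIntegrable := h.locallyIntegrable.add h'.locallyIntegrable
  locallyIntegrable_deriv := h.locallyIntegrable_deriv.add h'.locallyIntegrable_deriv
  integral_eq φ hφ hc := by
    have hd : Continuous fun x => fderiv ℝ φ x v :=
      (hφ.continuous_fderiv (by simp)).clm_apply continuous_const
    have hdc : HasCompactSupport fun x => fderiv ℝ φ x v := hc.fderiv_apply (𝕜 := ℝ) v
    simp only [Pi.add_apply, smul_add]
    rw [integral_add (h.locallyIntegrable.integrable_smul_left_of_hasCompactSupport hd hdc)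
        (h'.locallyIntegrable.integrable_smul_left_of_hasCompactSupport hd hdc),
      integral_add (h.locallyIntegrable_deriv.integrable_smul_left_of_hasCompactSupport
        hφ.continuous hc)
        (h'.locallyIntegrable_deriv.integrable_smul_left_of_hasCompactSupport hφ.continuous hc),
      h.integral_eq φ hφ hc, h'.integral_eq φ hφ hc, neg_add]

end WeakDerivatives

/-- `L²(ℝⁿ; ℂ)`. -/
abbrev L2 (n : ℕ) : Type := Lp ℂ 2 (volume : Measure (Space n))

/-- The Hilbert space `H¹(ℝⁿ; ℂ)`, realized as the space of pairs `(f, ∇f)` of an `L²` function and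
its weak gradient, when the latter is in `L²`. The inherited norm is the usual one,
`‖f‖² = ‖f‖²_{L²} + ∑ⱼ ‖∂ⱼf‖²_{L²}`. -/
def H1 (n : ℕ) : Submodule ℂ (WithLp 2 (L2 n × PiLp 2 (fun (_ : Fin n) => L2 n))) where
  carrier := {p | ∀ j, HasWeakDeriv (EuclideanSpace.single j (1 : ℝ)) p.fst (p.snd j)}
  zero_mem' _ := (HasWeakDeriv.zero _).congr (Lp.coeFn_zero ..) (Lp.coeFn_zero ..)
  add_mem' hp hq j := ((hp j).add (hq j)).congr (Lp.coeFn_add ..) (Lp.coeFn_add ..)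
  smul_mem' c _ hp j := ((hp j).const_smul c).congr (Lp.coeFn_smul ..) (Lp.coeFn_smul ..)

/-- The function underlying an element of `H¹`. -/
def H1.toFun {n : ℕ} (p : H1 n) : Space n → ℂ := (p.1.fst : L2 n)

/-- `u ∈ C¹(ℝ; H¹(ℝⁿ))`: the slices `u(t, ·)` are given by a continuously differentiable curve in
the Hilbert space `H¹(ℝⁿ)`. -/
def IsC1H1 {n : ℕ} (u : SpaceTime n → ℂ) : Prop :=
  ∃ U : ℝ → H1 n, ContDiff ℝ 1 U ∧ ∀ t, (fun x => u (t, x)) =ᵐ[volume] H1.toFun (U t)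

/-- The direction of `∂_t`. -/
def dirT (n : ℕ) : SpaceTime n := (1, 0)

/-- The direction of `∂_{x_j}`. -/
def dirX {n : ℕ} (j : Fin n) : SpaceTime n := (0, EuclideanSpace.single j 1)

/-- `(∂_t² + Δ) u`, with weak derivatives. -/
def laplaceTX {n : ℕ} (u : SpaceTime n → ℂ) (z : SpaceTime n) : ℂ :=
  weakDeriv (dirT n) (weakDeriv (dirT n) u) z + ∑ j, weakDeriv (dirX j) (weakDeriv (dirX j) u) z

/-- The values `ℂ × ℂⁿ` of `W`, with the Euclidean norm. -/
abbrev Covec (n : ℕ) : Type := WithLp 2 (ℂ × EuclideanSpace ℂ (Fin n))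

/-- `W · (∂_t, ∇) u`, with weak derivatives; the dot is bilinear. -/
def firstOrder {n : ℕ} (W : SpaceTime n → Covec n) (u : SpaceTime n → ℂ) (z : SpaceTime n) : ℂ :=
  (W z).fst * weakDeriv (dirT n) u z + ∑ j, (W z).snd j * weakDeriv (dirX j) u z

end Waveguide

end

/-! The theorem rests on a Carleman inequality whose weight depends on a single space coordinate,
say `r = x_j`. Take `φ' = μ q` with `q' = (1 + r²)^(-2ρ)`. Since `4ρ > 1`, this density is
integrable, so `q` can be normalized to satisfy `1 ≤ q ≤ Q`. Boundedness of `q` gives `φ ≤ μ Q |r|`;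
with `μ = 2λ / Q` the weight `exp (2φ)` is at most `exp (4λ|x|)`, which is exactly what the decay
hypothesis controls.

Conjugating the Laplacian of space-time by `exp φ` and integrating by parts gives, for smooth
compactly supported `v`, a bound of `∫ q' exp(2φ) (μ³ v² + μ |∇v|²)` by `3 ∫ exp(2φ) (Δv)²`
(`carleman_conjugated`, `carleman_smooth`). The gain carries the factor `q'`. The squares of the
potentials are at most `C² (1 + |x|²)^(-2ρ)`, hence at most `C² q'(x_j)`, so for large `μ` the lower
order terms are absorbed although `q'` decays (`carleman_solution`). Mollification extends the
inequality to cutoffs of `H²_loc` functions (`IsH2Limit.carleman`); real and imaginary parts are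
treated as a pair.

The solution has to be cut off at scale `R`. The weighted mass of `u` in a ball of space-time grows
only linearly in `R`, because the slices are uniformly bounded and only the time interval grows. No
decay of the gradient is assumed, but Caccioppoli's inequality with weight `exp(2φ)`
(`integral_gradient_le`) gives it the same linear growth; this again uses `q ≤ Q`. The cutoff errors
carry a factor `1 / R²`, so they are `O(1 / R)`. Letting `R → ∞` leaves `∫ q' exp(2φ) |u|² = 0`, and
`q' > 0` forces `u = 0` (`ae_eq_zero_of_carleman`). -/

noncomputable section

set_option linter.unusedSectionVars false

namespace Waveguide

open Filter Topology ContinuousLinearMap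
open scoped Convolution

/-! ### Mollification in `L²_loc` and weak derivatives. -/

section Mollification

variable {E : Type*} [NormedAddCommGroup E] [NormedSpace ℝ E] [FiniteDimensional ℝ E]
  [MeasureSpace E] [BorelSpace E] [(volume : Measure E).IsAddHaarMeasure]

/-- Translations act continuously on `L²`. -/
theorem tendsto_eLpNorm_translate_sub {f : E → ℂ} (hf : MemLp f 2 volume) :
    Tendsto (fun y : E => eLpNorm (fun x => f (x - y) - f x) 2 volume) (𝓝 0) (𝓝 0) := by
  have : Fact ((1 : ℝ≥0∞) ≤ 2) := ⟨by norm_num⟩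
  let g : E → C(E, E) := fun y => ⟨fun x => x - y, by fun_prop⟩
  have hg : Continuous g := ContinuousMap.continuous_of_continuous_uncurry _ (by
    change Continuous fun p : E × E => p.2 - p.1
    fun_prop)
  have hgm : ∀ y, MeasurePreserving (g y) (volume : Measure E) volume := fun y =>
    measurePreserving_sub_right volume y
  have hc : Continuous fun y => Lp.compMeasurePreserving (g y) (hgm y) (hf.toLp f) :=
    continuous_const.compMeasurePreservingLp hg hgm (by norm_num)
  have h0 : Lp.compMeasurePreserving (g 0) (hgm 0) (hf.toLp f) = hf.toLp f := by
    rw [Lp.toLp_compMeasurePreserving]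
    refine (MemLp.toLp_eq_toLp_iff _ _).2 (Eventually.of_forall fun x => ?_)
    simp [g]
  have ht := hc.tendsto 0
  rw [h0, tendsto_iff_edist_tendsto_0] at ht
  refine ht.congr fun y => ?_
  rw [Lp.toLp_compMeasurePreserving, Lp.edist_toLp_toLp]
  rfl

theorem eLpNorm_two_sq {α : Type*} [MeasurableSpace α] {F : Type*} [NormedAddCommGroup F]
    (f : α → F) (μ : Measure α) : eLpNorm f 2 μ ^ 2 = ∫⁻ x, ‖f x‖ₑ ^ 2 ∂μ := by
  have h := eLpNorm_nnreal_pow_eq_lintegral (f := f) (μ := μ) (p := 2) (by norm_num)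
  simpa using h

/-- For `|y| ≤ 1`, the values of `f (x - y)` with `x ∈ K` only involve the closed 1-thickening of
`K`. Truncating `f` there changes nothing on `K` and reduces the claim to continuity of translations
in the global `L²`. -/
theorem tendsto_setLIntegral_translate_sub {f : E → ℂ} (hf : MemL2loc f) {K : Set E}
    (hK : IsCompact K) :
    Tendsto (fun y : E => ∫⁻ x in K, ‖f (x - y) - f x‖ₑ ^ 2) (𝓝 0) (𝓝 0) := by
  set K' := Metric.cthickening 1 K
  have hK' : IsCompact K' := hK.cthickening
  have hF : MemLp (K'.indicator f) 2 volume :=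
    (memLp_indicator_iff_restrict hK'.measurableSet).2 (hf K' hK')
  have h2 : Tendsto (fun y : E => eLpNorm (fun x => K'.indicator f (x - y) - K'.indicator f x) 2
      volume ^ 2) (𝓝 0) (𝓝 0) := by
    have := (ENNReal.continuous_pow 2).continuousAt.tendsto.comp (tendsto_eLpNorm_translate_sub hF)
    simpa using! this
  refine tendsto_of_tendsto_of_tendsto_of_le_of_le' tendsto_const_nhds h2
    (Eventually.of_forall fun _ => zero_le) ?_
  filter_upwards [Metric.closedBall_mem_nhds (0 : E) one_pos] with y hy
  rw [eLpNorm_two_sq]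
  refine le_trans (le_of_eq ?_) (setLIntegral_le_lintegral K _)
  refine setLIntegral_congr_fun hK.measurableSet fun x hx => ?_
  have h1 : x ∈ K' := Metric.self_subset_cthickening K hx
  have h3 : x - y ∈ K' := by
    refine Metric.mem_cthickening_of_dist_le _ x _ _ hx ?_
    simpa [dist_eq_norm] using hy
  simp [h1, h3]

/-- Jensen's inequality for the average of `h` against a probability density `ρ`. -/
theorem enorm_integral_smul_sq_le {ρ : E → ℝ} (hρ : Continuous ρ) (hρ0 : ∀ y, 0 ≤ ρ y)
    (hρ1 : ∫⁻ y, ENNReal.ofReal (ρ y) = 1) {h : E → ℂ} (hh : AEStronglyMeasurable h volume) :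
    ‖∫ y, ρ y • h y‖ₑ ^ 2 ≤ ∫⁻ y, ENNReal.ofReal (ρ y) * ‖h y‖ₑ ^ 2 := by
  set ν := (volume : Measure E).withDensity fun y => ENNReal.ofReal (ρ y)
  have hm : Measurable fun y => ENNReal.ofReal (ρ y) := by fun_prop
  have : IsProbabilityMeasure ν := ⟨by simp [ν, hρ1]⟩
  have hν : AEStronglyMeasurable h ν := hh.mono_ac (withDensity_absolutelyContinuous _ _)
  have h1 : ∫ y, ρ y • h y = ∫ y, h y ∂ν := by
    rw [integral_withDensity_eq_integral_toReal_smul hm (by simp)]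
    exact integral_congr_ae (Eventually.of_forall fun y => by simp [hρ0])
  have h2 : ∫⁻ y, ENNReal.ofReal (ρ y) * ‖h y‖ₑ ^ 2 = ∫⁻ y, ‖h y‖ₑ ^ 2 ∂ν := by
    rw [lintegral_withDensity_eq_lintegral_mul₀' hm.aemeasurable (by fun_prop)]
    rfl
  rw [h1, h2, ← eLpNorm_two_sq]
  gcongr
  refine (enorm_integral_le_lintegral_enorm _).trans ?_
  rw [← eLpNorm_one_eq_lintegral_enorm]
  exact eLpNorm_le_eLpNorm_of_exponent_le (by norm_num) hν

/-- The mollification of `f` by the normalized bump function `φ`. -/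
def mollify (φ : ContDiffBump (0 : E)) (f : E → ℂ) : E → ℂ :=
  φ.normed volume ⋆[lsmul ℝ ℝ, volume] f

theorem mollify_apply (φ : ContDiffBump (0 : E)) (f : E → ℂ) (x : E) :
    mollify φ f x = ∫ y, φ.normed volume y • f (x - y) := rfl

theorem contDiff_mollify (φ : ContDiffBump (0 : E)) {f : E → ℂ}
    (hf : LocallyIntegrable f volume) : ContDiff ℝ ∞ (mollify φ f) :=
  φ.hasCompactSupport_normed.contDiff_convolution_left _ φ.contDiff_normed hf

theorem mollify_sub_apply (φ : ContDiffBump (0 : E)) {f : E → ℂ}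
    (hf : LocallyIntegrable f volume) (x : E) :
    mollify φ f x - f x = ∫ y, φ.normed volume y • (f (x - y) - f x) := by
  have hi : Integrable (fun y => φ.normed volume y • f (x - y)) volume :=
    (φ.hasCompactSupport_normed.convolutionExists_left (lsmul ℝ ℝ) φ.continuous_normed hf x)
  simp_rw [smul_sub]
  rw [integral_sub hi (φ.integrable_normed.smul_const _), φ.integral_normed_smul, mollify_apply]

theorem lintegral_normed (φ : ContDiffBump (0 : E)) :
    ∫⁻ y, ENNReal.ofReal (φ.normed volume y) = 1 := by
  rw [← ofReal_integral_eq_lintegral_ofReal φ.integrable_normed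
    (Eventually.of_forall φ.nonneg_normed), φ.integral_normed, ENNReal.ofReal_one]

theorem aestronglyMeasurable_translate {f : E → ℂ} (hf : AEStronglyMeasurable f volume) (x : E) :
    AEStronglyMeasurable (fun y => f (x - y)) volume :=
  hf.comp_quasiMeasurePreserving (quasiMeasurePreserving_sub_left volume x)

/-- The mollification error is an average of `f (x - y) - f x` against the bump, so Jensen's
inequality followed by Tonelli bounds its `L²(K)` norm by the worst translation error over the
support of the bump. -/
theorem setLIntegral_mollify_sub_le (φ : ContDiffBump (0 : E)) {f : E → ℂ}
    (hf : LocallyIntegrable f volume) (K : Set E) {ε : ℝ≥0∞}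
    (h : ∀ y ∈ Metric.ball (0 : E) φ.rOut, ∫⁻ x in K, ‖f (x - y) - f x‖ₑ ^ 2 ≤ ε) :
    ∫⁻ x in K, ‖mollify φ f x - f x‖ₑ ^ 2 ≤ ε := by
  have hm := hf.aestronglyMeasurable
  have hmeas : AEMeasurable (fun p : E × E =>
      ENNReal.ofReal (φ.normed volume p.2) * ‖f (p.1 - p.2) - f p.1‖ₑ ^ 2)
      (((volume : Measure E).restrict K).prod volume) := by
    have h1 : AEStronglyMeasurable (fun p : E × E => f (p.1 - p.2)) (volume.prod volume) :=
      hm.comp_quasiMeasurePreserving (quasiMeasurePreserving_sub volume volume)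
    have h2 : AEStronglyMeasurable (fun p : E × E => f p.1) (volume.prod volume) := hm.comp_fst
    have h3 : AEMeasurable (fun p : E × E =>
        ENNReal.ofReal (φ.normed volume p.2) * ‖f (p.1 - p.2) - f p.1‖ₑ ^ 2)
        ((volume : Measure E).prod volume) := by
      refine AEMeasurable.mul ?_ ((h1.sub h2).enorm.pow_const 2)
      exact (φ.continuous_normed.measurable.ennreal_ofReal.comp measurable_snd).aemeasurable
    exact h3.mono_ac (Measure.restrict_le_self.absolutelyContinuous.prod .rfl)
  calc ∫⁻ x in K, ‖mollify φ f x - f x‖ₑ ^ 2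
      ≤ ∫⁻ x in K, ∫⁻ y, ENNReal.ofReal (φ.normed volume y) * ‖f (x - y) - f x‖ₑ ^ 2 := by
        refine lintegral_mono fun x => ?_
        simp only [mollify_sub_apply φ hf]
        exact enorm_integral_smul_sq_le φ.continuous_normed φ.nonneg_normed (lintegral_normed φ)
          ((aestronglyMeasurable_translate hm x).sub aestronglyMeasurable_const)
    _ = ∫⁻ y, ∫⁻ x in K, ENNReal.ofReal (φ.normed volume y) * ‖f (x - y) - f x‖ₑ ^ 2 :=
        lintegral_lintegral_swap hmeas
    _ ≤ ∫⁻ y, ENNReal.ofReal (φ.normed volume y) * ε := by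
        refine lintegral_mono fun y => ?_
        rw [lintegral_const_mul' _ _ ENNReal.ofReal_ne_top]
        by_cases hy : y ∈ Metric.ball (0 : E) φ.rOut
        · gcongr
          exact h y hy
        · have : φ.normed volume y = 0 := by
            rw [← φ.support_normed_eq (μ := volume)] at hy
            simpa using hy
          simp [this]
    _ = ε := by
        rw [lintegral_mul_const _ (by have := φ.continuous_normed (μ := volume); fun_prop),
          lintegral_normed, one_mul]

/-- Convergence in `L²_loc`. -/
def L2locTendsto {G : Type*} [NormedAddCommGroup G] (s : ℕ → E → G) (f : E → G) : Prop :=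
  ∀ K : Set E, IsCompact K →
    Tendsto (fun k => eLpNorm (s k - f) 2 (volume.restrict K)) atTop (𝓝 0)

theorem l2locTendsto_mollify {φ : ℕ → ContDiffBump (0 : E)}
    (hφ : Tendsto (fun k => (φ k).rOut) atTop (𝓝 0)) {f : E → ℂ}
    (hf : LocallyIntegrable f volume) (hf2 : MemL2loc f) :
    L2locTendsto (fun k => mollify (φ k) f) f := by
  intro K hK
  have h1 : Tendsto (fun k => ∫⁻ x in K, ‖mollify (φ k) f x - f x‖ₑ ^ 2) atTop (𝓝 0) := by
    rw [ENNReal.tendsto_nhds_zero]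
    intro ε hε
    have h2 := (ENNReal.tendsto_nhds_zero.1 (tendsto_setLIntegral_translate_sub hf2 hK)) ε hε
    obtain ⟨δ, hδ, hδ'⟩ := Metric.eventually_nhds_iff_ball.1 h2
    filter_upwards [hφ.eventually (gt_mem_nhds hδ)] with k hk
    exact setLIntegral_mollify_sub_le (φ k) hf K fun y hy =>
      hδ' y (Metric.ball_subset_ball hk.le hy)
  have h3 := (ENNReal.continuous_rpow_const (y := 1 / 2)).continuousAt.tendsto.comp h1
  simp only [Function.comp_def] at h3
  rw [ENNReal.zero_rpow_of_pos (by norm_num)] at h3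
  refine h3.congr fun k => ?_
  have := eLpNorm_two_sq (mollify (φ k) f - f) (volume.restrict K)
  simp only [Pi.sub_apply] at this
  rw [← this, ← ENNReal.rpow_natCast, ← ENNReal.rpow_mul]
  norm_num

/-- Mollification commutes with weak derivatives. -/
theorem fderiv_mollify (φ : ContDiffBump (0 : E)) {v : E} {f g : E → ℂ}
    (h : HasWeakDeriv v f g) (x : E) : fderiv ℝ (mollify φ f) x v = mollify φ g x := by
  have h1 := (φ.hasCompactSupport_normed (μ := volume)).hasFDerivAt_convolution_left
    (lsmul ℝ ℝ) (φ.contDiff_normed (n := 1)) h.locallyIntegrable x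
  have hex : ConvolutionExistsAt (fderiv ℝ (φ.normed volume)) f x
      ((lsmul ℝ ℝ : ℝ →L[ℝ] ℂ →L[ℝ] ℂ).precompL E) volume :=
    ((φ.hasCompactSupport_normed (μ := volume)).fderiv (𝕜 := ℝ)).convolutionExists_left _
      ((φ.contDiff_normed (n := 1)).continuous_fderiv (by simp)) h.locallyIntegrable x
  have h2 : fderiv ℝ (mollify φ f) x v
      = ∫ y, (fderiv ℝ (φ.normed volume) y v) • f (x - y) := by
    rw [mollify, h1.fderiv, convolution_def, ContinuousLinearMap.integral_apply hex]
    rfl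
  -- The weak derivative is tested against the reflected bump `y ↦ φ (x - y)`; the sign from the
  -- reflection cancels the sign in the integration by parts.
  let ψ : E → ℝ := fun y => φ.normed volume (x - y)
  have hψ : ContDiff ℝ ∞ ψ := φ.contDiff_normed.comp (contDiff_const.sub contDiff_id)
  have hψc : HasCompactSupport ψ :=
    φ.hasCompactSupport_normed.comp_homeomorph (Homeomorph.subLeft x)
  have hψd : ∀ y, fderiv ℝ ψ y v = - fderiv ℝ (φ.normed volume) (x - y) v := by
    intro y
    have ha : HasFDerivAt (φ.normed volume) (fderiv ℝ (φ.normed volume) (x - y)) (x - y) :=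
      ((φ.contDiff_normed (n := 1)).differentiable (by simp) _).hasFDerivAt
    have hb : HasFDerivAt (fun y : E => x - y) (-ContinuousLinearMap.id ℝ E) y :=
      (hasFDerivAt_id y).const_sub x
    rw [show ψ = φ.normed volume ∘ fun y => x - y from rfl, (ha.comp y hb).fderiv]
    simp
  have h3 := h.integral_eq ψ hψ hψc
  rw [h2, mollify_apply, ← integral_sub_left_eq_self _ volume x,
    ← integral_sub_left_eq_self (fun y => φ.normed volume y • g (x - y)) volume x]
  simp only [sub_sub_cancel]
  simp only [hψd, neg_smul, integral_neg, neg_inj] at h3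
  exact h3

end Mollification

/-! ### Calculus of `L²_loc` convergence and `H²_loc` limits of smooth functions. -/

section LocalConvergence

variable {E : Type*} [NormedAddCommGroup E] [NormedSpace ℝ E] [FiniteDimensional ℝ E]
  [MeasureSpace E] [BorelSpace E] [(volume : Measure E).IsAddHaarMeasure]

/-- `f ∈ L²_loc`, for functions with values in an arbitrary normed group. -/
def IsL2loc {G : Type*} [NormedAddCommGroup G] (f : E → G) : Prop :=
  ∀ K : Set E, IsCompact K → MemLp f 2 (volume.restrict K)

theorem isL2loc_of_continuous {G : Type*} [NormedAddCommGroup G] {f : E → G}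
    (hf : Continuous f) : IsL2loc f := fun K hK => by
  have : IsFiniteMeasure ((volume : Measure E).restrict K) := ⟨by simpa using hK.measure_lt_top⟩
  obtain ⟨M, hM⟩ := hK.exists_bound_of_continuousOn hf.continuousOn
  exact MemLp.of_bound (hf.continuousOn.aestronglyMeasurable_of_isCompact hK hK.measurableSet) M
    ((ae_restrict_iff' hK.measurableSet).2 (Eventually.of_forall hM))

theorem IsL2loc.add {f g : E → ℝ} (hf : IsL2loc f) (hg : IsL2loc g) :
    IsL2loc fun x => f x + g x := fun K hK => (hf K hK).add (hg K hK)

theorem isL2loc_sum {ι : Type*} [Fintype ι] {f : ι → E → ℝ} (hf : ∀ i, IsL2loc (f i)) :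
    IsL2loc fun x => ∑ i, f i x := fun K hK => memLp_finsetSum _ fun i _ => hf i K hK

theorem IsL2loc.continuous_mul {g f : E → ℝ} (hg : Continuous g) (hf : IsL2loc f) :
    IsL2loc fun x => g x * f x := fun K hK => by
  obtain ⟨M, hM⟩ := hK.exists_bound_of_continuousOn hg.continuousOn
  refine MemLp.of_le_mul (c := M) (hf K hK)
    ((hg.aestronglyMeasurable).mul (hf K hK).aestronglyMeasurable)
    ((ae_restrict_iff' hK.measurableSet).2 (Eventually.of_forall fun x hx => ?_))
  rw [norm_mul]
  gcongr
  exact hM x hx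

/-- The product of two `L²_loc` functions is integrable if it vanishes off a compact set. -/
theorem IsL2loc.integrable_mul {f g : E → ℝ} (hf : IsL2loc f) (hg : IsL2loc g) {K : Set E}
    (hK : IsCompact K) (h0 : ∀ x ∉ K, f x * g x = 0) :
    Integrable (fun x => f x * g x) volume := by
  rw [← integrableOn_iff_integrable_of_support_subset (s := K)]
  · exact (hf K hK).integrable_mul (hg K hK)
  · intro x hx
    by_contra hxK
    exact hx (h0 x hxK)

theorem L2locTendsto.add {s t : ℕ → E → ℝ} {a b : E → ℝ}
    (hsm : ∀ k, IsL2loc (s k)) (htm : ∀ k, IsL2loc (t k)) (ha : IsL2loc a) (hb : IsL2loc b)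
    (hs : L2locTendsto s a) (ht : L2locTendsto t b) :
    L2locTendsto (fun k x => s k x + t k x) fun x => a x + b x := fun K hK => by
  have h := (hs K hK).add (ht K hK)
  rw [add_zero] at h
  refine tendsto_of_tendsto_of_tendsto_of_le_of_le tendsto_const_nhds h
    (fun _ => zero_le) fun k => ?_
  refine le_trans (le_of_eq ?_) (eLpNorm_add_le ((hsm k K hK).sub (ha K hK)).aestronglyMeasurable
    ((htm k K hK).sub (hb K hK)).aestronglyMeasurable (by norm_num))
  congr 1
  ext x
  simp only [Pi.sub_apply, Pi.add_apply]
  ring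

theorem L2locTendsto.continuous_mul {s : ℕ → E → ℝ} {a g : E → ℝ} (hg : Continuous g)
    (hs : L2locTendsto s a) : L2locTendsto (fun k x => g x * s k x) fun x => g x * a x :=
    fun K hK => by
  obtain ⟨M, hM⟩ := hK.exists_bound_of_continuousOn hg.continuousOn
  have h := ENNReal.Tendsto.const_mul (a := ENNReal.ofReal M) (hs K hK)
    (Or.inr ENNReal.ofReal_ne_top)
  rw [mul_zero] at h
  refine tendsto_of_tendsto_of_tendsto_of_le_of_le tendsto_const_nhds h
    (fun _ => zero_le) fun k => ?_
  refine eLpNorm_le_mul_eLpNorm_of_ae_le_mul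
    ((ae_restrict_iff' hK.measurableSet).2 (Eventually.of_forall fun x hx => ?_)) 2
  simp only [Pi.sub_apply, ← mul_sub, norm_mul]
  gcongr
  exact hM x hx

theorem l2locTendsto_sum {ι : Type*} [Fintype ι] {s : ι → ℕ → E → ℝ} {a : ι → E → ℝ}
    (hsm : ∀ i k, IsL2loc (s i k)) (ha : ∀ i, IsL2loc (a i))
    (hs : ∀ i, L2locTendsto (s i) (a i)) :
    L2locTendsto (fun k x => ∑ i, s i k x) fun x => ∑ i, a i x := fun K hK => by
  have h := tendsto_finsetSum Finset.univ fun i _ => hs i K hK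
  rw [Finset.sum_const_zero] at h
  refine tendsto_of_tendsto_of_tendsto_of_le_of_le tendsto_const_nhds h
    (fun _ => zero_le) fun k => ?_
  refine le_trans (le_of_eq ?_) (eLpNorm_sum_le (fun i _ =>
    ((hsm i k K hK).sub (ha i K hK)).aestronglyMeasurable) (by norm_num))
  congr 1
  ext x
  simp

/-- With all products vanishing off one compact `K`, the integrals are inner products in `L²(K)`,
and the inner product is jointly continuous. Every quadratic term below passes to the limit through
this lemma. -/
theorem L2locTendsto.tendsto_integral_mul {s t : ℕ → E → ℝ} {a b : E → ℝ}
    (hsm : ∀ k, IsL2loc (s k)) (htm : ∀ k, IsL2loc (t k)) (ha : IsL2loc a) (hb : IsL2loc b)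
    (hs : L2locTendsto s a) (ht : L2locTendsto t b) {K : Set E} (hK : IsCompact K)
    (h0 : ∀ k, ∀ x ∉ K, s k x * t k x = 0) (h0' : ∀ x ∉ K, a x * b x = 0) :
    Tendsto (fun k => ∫ x, s k x * t k x) atTop (𝓝 (∫ x, a x * b x)) := by
  have : Fact ((1 : ℝ≥0∞) ≤ 2) := ⟨by norm_num⟩
  have key : ∀ {f g : E → ℝ} (hf : IsL2loc f) (hg : IsL2loc g), (∀ x ∉ K, f x * g x = 0) →
      ∫ x, f x * g x = inner ℝ ((hg K hK).toLp g) ((hf K hK).toLp f) := by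
    intro f g hf hg hfg
    rw [← setIntegral_eq_integral_of_forall_compl_eq_zero hfg, L2.inner_def]
    refine integral_congr_ae ?_
    filter_upwards [(hf K hK).coeFn_toLp, (hg K hK).coeFn_toLp] with x h1 h2
    rw [h1, h2]
    simp
  rw [key ha hb h0']
  simp_rw [fun k => key (hsm k) (htm k) (h0 k)]
  refine Tendsto.inner ?_ ?_
  · exact (Lp.tendsto_Lp_iff_tendsto_eLpNorm'' _ (fun k => htm k K hK) _ (hb K hK)).2 (ht K hK)
  · exact (Lp.tendsto_Lp_iff_tendsto_eLpNorm'' _ (fun k => hsm k K hK) _ (ha K hK)).2 (hs K hK)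

/-- The directional derivative of `f` along the constant vector field `v`. -/
def dirDeriv {G : Type*} [NormedAddCommGroup G] [NormedSpace ℝ G] (v : E) (f : E → G) : E → G :=
  fun x => fderiv ℝ f x v

theorem contDiff_dirDeriv {G : Type*} [NormedAddCommGroup G] [NormedSpace ℝ G] {v : E} {f : E → G}
    (hf : ContDiff ℝ ∞ f) : ContDiff ℝ ∞ (dirDeriv v f) :=
  (hf.fderiv_right (m := ∞) (by simp)).clm_apply contDiff_const

theorem dirDeriv_clm_comp {G H : Type*} [NormedAddCommGroup G] [NormedSpace ℝ G]
    [NormedAddCommGroup H] [NormedSpace ℝ H] {v : E} {f : E → G}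
    (hf : ContDiff ℝ ∞ f) (L : G →L[ℝ] H) :
    dirDeriv v (fun x => L (f x)) = fun x => L (dirDeriv v f x) := by
  ext x
  have h : HasFDerivAt f (fderiv ℝ f x) x := (hf.differentiable (by simp) x).hasFDerivAt
  simp only [dirDeriv]
  have h2 : HasFDerivAt (fun x => L (f x)) (L.comp (fderiv ℝ f x)) x :=
    L.hasFDerivAt.comp x h
  rw [h2.fderiv]
  rfl

/-- `a` is an `H²_loc` limit of smooth functions, in the sense that `s k → a`, `∂ᵢ s k → a₁ i` and
`∂ᵢ² s k → a₂ i` in `L²_loc` along the directions `e i`. -/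
structure IsH2Limit {ι : Type*} (e : ι → E) (a : E → ℝ) (a₁ a₂ : ι → E → ℝ) : Prop where
  mem : IsL2loc a
  mem₁ : ∀ i, IsL2loc (a₁ i)
  mem₂ : ∀ i, IsL2loc (a₂ i)
  approx : ∃ s : ℕ → E → ℝ, (∀ k, ContDiff ℝ ∞ (s k)) ∧ L2locTendsto s a ∧
    (∀ i, L2locTendsto (fun k => dirDeriv (e i) (s k)) (a₁ i)) ∧
    ∀ i, L2locTendsto (fun k => dirDeriv (e i) (dirDeriv (e i) (s k))) (a₂ i)

theorem L2locTendsto.clm_comp {s : ℕ → E → ℂ} {a : E → ℂ} (hs : L2locTendsto s a)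
    (L : ℂ →L[ℝ] ℝ) : L2locTendsto (fun k x => L (s k x)) fun x => L (a x) := fun K hK => by
  have h := ENNReal.Tendsto.const_mul (a := ENNReal.ofReal ‖L‖) (hs K hK)
    (Or.inr ENNReal.ofReal_ne_top)
  rw [mul_zero] at h
  refine tendsto_of_tendsto_of_tendsto_of_le_of_le tendsto_const_nhds h
    (fun _ => zero_le) fun k => ?_
  refine eLpNorm_le_mul_eLpNorm_of_ae_le_mul (Eventually.of_forall fun x => ?_) 2
  simp only [Pi.sub_apply, ← map_sub]
  exact L.le_opNorm _

/-- Real-linear images of `H²_loc` functions with weak derivatives are `H²_loc` limits of smooth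
functions. -/
theorem isH2Limit_of_hasWeakDeriv {ι : Type*} {e : ι → E} {u : E → ℂ} {u₁ u₂ : ι → E → ℂ}
    (hu : MemL2loc u) (hu₁ : ∀ i, MemL2loc (u₁ i)) (hu₂ : ∀ i, MemL2loc (u₂ i))
    (h₁ : ∀ i, HasWeakDeriv (e i) u (u₁ i)) (h₂ : ∀ i, HasWeakDeriv (e i) (u₁ i) (u₂ i))
    (hli : LocallyIntegrable u volume) (L : ℂ →L[ℝ] ℝ) :
    IsH2Limit e (fun x => L (u x)) (fun i x => L (u₁ i x)) (fun i x => L (u₂ i x)) where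
  mem K hK := L.comp_memLp' (hu K hK)
  mem₁ i K hK := L.comp_memLp' (hu₁ i K hK)
  mem₂ i K hK := L.comp_memLp' (hu₂ i K hK)
  approx := by
    let φ : ℕ → ContDiffBump (0 : E) := fun k =>
      ⟨1 / (k + 2), 1 / (k + 1), by positivity, by gcongr; norm_num⟩
    have hφ : Tendsto (fun k => (φ k).rOut) atTop (𝓝 0) := tendsto_one_div_add_atTop_nhds_zero_nat
    have hD : ∀ k i, dirDeriv (e i) (mollify (φ k) u) = mollify (φ k) (u₁ i) := fun k i =>
      funext fun x => fderiv_mollify (φ k) (h₁ i) x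
    have hD₂ : ∀ k i, dirDeriv (e i) (mollify (φ k) (u₁ i)) = mollify (φ k) (u₂ i) := fun k i =>
      funext fun x => fderiv_mollify (φ k) (h₂ i) x
    have hs : ∀ k, ContDiff ℝ ∞ (mollify (φ k) u) := fun k => contDiff_mollify (φ k) hli
    have hs₁ : ∀ k i, ContDiff ℝ ∞ (mollify (φ k) (u₁ i)) := fun k i =>
      contDiff_mollify (φ k) (h₁ i).locallyIntegrable_deriv
    refine ⟨fun k x => L (mollify (φ k) u x), fun k => L.contDiff.comp (hs k),
      (l2locTendsto_mollify hφ hli hu).clm_comp L, fun i => ?_, fun i => ?_⟩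
    · simp_rw [fun k => dirDeriv_clm_comp (v := e i) (hs k) L, hD]
      exact (l2locTendsto_mollify hφ (h₁ i).locallyIntegrable_deriv (hu₁ i)).clm_comp L
    · simp_rw [fun k => dirDeriv_clm_comp (v := e i) (hs k) L, hD,
        fun k => dirDeriv_clm_comp (v := e i) (hs₁ k i) L, hD₂]
      exact (l2locTendsto_mollify hφ (h₂ i).locallyIntegrable_deriv (hu₂ i)).clm_comp L

end LocalConvergence

/-! ### Directional derivatives and the conjugated Carleman identity. -/

section Carleman

variable {E : Type*} [NormedAddCommGroup E] [NormedSpace ℝ E]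

theorem dirDeriv_add {v : E} {f g : E → ℝ} (hf : ContDiff ℝ ∞ f) (hg : ContDiff ℝ ∞ g) (x : E) :
    dirDeriv v (fun x => f x + g x) x = dirDeriv v f x + dirDeriv v g x := by
  simp only [dirDeriv]
  rw [fderiv_fun_add (hf.differentiable (by simp) x) (hg.differentiable (by simp) x)]
  rfl

theorem dirDeriv_mul {v : E} {f g : E → ℝ} (hf : ContDiff ℝ ∞ f) (hg : ContDiff ℝ ∞ g) (x : E) :
    dirDeriv v (fun x => f x * g x) x = f x * dirDeriv v g x + dirDeriv v f x * g x := by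
  simp only [dirDeriv]
  rw [fderiv_fun_mul (hf.differentiable (by simp) x) (hg.differentiable (by simp) x)]
  simp [mul_comm]

theorem dirDeriv_const_mul {v : E} {f : E → ℝ} (c : ℝ) (hf : ContDiff ℝ ∞ f) (x : E) :
    dirDeriv v (fun x => c * f x) x = c * dirDeriv v f x := by
  simp only [dirDeriv]
  rw [fderiv_const_mul (hf.differentiable (by simp) x)]
  simp

theorem dirDeriv_sum {ι : Type*} [Fintype ι] {v : E} {f : ι → E → ℝ}
    (hf : ∀ i, ContDiff ℝ ∞ (f i)) (x : E) :
    dirDeriv v (fun x => ∑ i, f i x) x = ∑ i, dirDeriv v (f i) x := by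
  simp only [dirDeriv]
  rw [fderiv_fun_sum fun i _ => (hf i).differentiable (by simp) x]
  simp

theorem dirDeriv_comp_clm {v : E} {p : ℝ → ℝ} (hp : ContDiff ℝ ∞ p) (ℓ : E →L[ℝ] ℝ) (x : E) :
    dirDeriv v (fun x => p (ℓ x)) x = ℓ v * deriv p (ℓ x) := by
  have h : HasFDerivAt (fun x => p (ℓ x)) (deriv p (ℓ x) • ℓ) x :=
    (hp.differentiable (by simp) (ℓ x)).hasDerivAt.comp_hasFDerivAt x ℓ.hasFDerivAt
  simp only [dirDeriv, h.fderiv]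
  simp [mul_comm]

theorem dirDeriv_comm {v w : E} {f : E → ℝ} (hf : ContDiff ℝ ∞ f) (x : E) :
    dirDeriv v (dirDeriv w f) x = dirDeriv w (dirDeriv v f) x := by
  have hd : DifferentiableAt ℝ (fderiv ℝ f) x :=
    (hf.fderiv_right (m := ∞) (by simp)).differentiable (by simp) x
  have h : ∀ v w : E, dirDeriv v (dirDeriv w f) x = fderiv ℝ (fderiv ℝ f) x v w := by
    intro v w
    change fderiv ℝ (fun y => fderiv ℝ f y w) x v = _
    rw [fderiv_clm_apply hd (differentiableAt_const w)]
    simp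
  rw [h, h]
  exact (hf.contDiffAt.isSymmSndFDerivAt 
    (by simpa using (WithTop.coe_le_coe.2 le_top : ((2 : ℕ∞) : WithTop ℕ∞) ≤ (⊤ : ℕ∞)))) v w

theorem hasCompactSupport_dirDeriv {v : E} {f : E → ℝ} (hf : HasCompactSupport f) :
    HasCompactSupport (dirDeriv v f) := hf.fderiv_apply (𝕜 := ℝ) v

variable [FiniteDimensional ℝ E]
  [MeasureSpace E] [BorelSpace E] [(volume : Measure E).IsAddHaarMeasure]

theorem integral_dirDeriv_eq_zero {v : E} {f : E → ℝ} (hf : ContDiff ℝ ∞ f)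
    (hc : HasCompactSupport f) : ∫ x, dirDeriv v f x = 0 := by
  have h := integral_mul_fderiv_eq_neg_fderiv_mul_of_integrable (μ := (volume : Measure E))
    (f := fun _ : E => (1 : ℝ)) (g := f) (v := v) (by simp) (by
      simpa [dirDeriv, Function.comp_def] using! ((contDiff_dirDeriv (v := v)
        hf).continuous.integrable_of_hasCompactSupport (hasCompactSupport_dirDeriv hc)))
    (by simpa using hf.continuous.integrable_of_hasCompactSupport hc)
    (by intros; fun_prop) (fun x _ => hf.differentiable (by simp) x)
  simpa [dirDeriv] using h

/-- The Carleman inequality for the operator conjugated with `exp φ`, `φ' = p`, for a weight that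
depends on the coordinate `ℓ` only. -/
theorem carleman_conjugated {ι : Type*} [Fintype ι] [DecidableEq ι] {e : ι → E} {i₀ : ι}
    {ℓ : E →L[ℝ] ℝ} (hℓ : ∀ i, ℓ (e i) = if i = i₀ then 1 else 0) {p : ℝ → ℝ}
    (hp : ContDiff ℝ ∞ p) (hp' : ∀ r, 0 ≤ deriv p r) {f : E → ℝ} (hf : ContDiff ℝ ∞ f)
    (hc : HasCompactSupport f) :
    ∫ x, (2 * deriv p (ℓ x) * ∑ i, dirDeriv (e i) f x ^ 2 +
        (2 * p (ℓ x) ^ 2 * deriv p (ℓ x) - 2 * deriv (deriv (deriv p)) (ℓ x)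
          - deriv p (ℓ x) ^ 2) * f x ^ 2) ≤
      ∫ x, ((∑ i, dirDeriv (e i) (dirDeriv (e i) f) x) - 2 * p (ℓ x) * dirDeriv (e i₀) f x
        + (p (ℓ x) ^ 2 - deriv p (ℓ x)) * f x) ^ 2 := by
  have hp1 : ContDiff ℝ ∞ (deriv p) := (contDiff_infty_iff_deriv.1 hp).2
  have hp2 : ContDiff ℝ ∞ (deriv (deriv p)) := (contDiff_infty_iff_deriv.1 hp1).2
  have hp3 : ContDiff ℝ ∞ (deriv (deriv (deriv p))) := (contDiff_infty_iff_deriv.1 hp2).2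
  have hP : ContDiff ℝ ∞ fun x => p (ℓ x) := hp.comp ℓ.contDiff
  have hP1 : ContDiff ℝ ∞ fun x => deriv p (ℓ x) := hp1.comp ℓ.contDiff
  have hP2 : ContDiff ℝ ∞ fun x => deriv (deriv p) (ℓ x) := hp2.comp ℓ.contDiff
  have hP3 : ContDiff ℝ ∞ fun x => deriv (deriv (deriv p)) (ℓ x) := hp3.comp ℓ.contDiff
  have hf1 : ∀ i, ContDiff ℝ ∞ (dirDeriv (e i) f) := fun i => contDiff_dirDeriv hf
  have hf2 : ∀ i j, ContDiff ℝ ∞ (dirDeriv (e i) (dirDeriv (e j) f)) := fun i j =>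
    contDiff_dirDeriv (hf1 j)
  have hc1 : ∀ i, HasCompactSupport (dirDeriv (e i) f) := fun i => hasCompactSupport_dirDeriv hc
  -- the divergence terms
  let H : ι → E → ℝ := fun i x => (p (ℓ x) * dirDeriv (e i₀) f x + deriv p (ℓ x) * f x) *
    (-4 * dirDeriv (e i) f x)
  let G : E → ℝ := fun x => p (ℓ x) * ∑ i, (dirDeriv (e i) f x * dirDeriv (e i) f x) +
    ((deriv (deriv p) (ℓ x) + -1 * (p (ℓ x) * (p (ℓ x) * p (ℓ x)))) * f x) * f x
  have hH : ∀ i, ContDiff ℝ ∞ (H i) := fun i =>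
    ((hP.mul (hf1 i₀)).add (hP1.mul hf)).mul (contDiff_const.mul (hf1 i))
  have hsum : ContDiff ℝ ∞ fun x => ∑ i, (dirDeriv (e i) f x * dirDeriv (e i) f x) :=
    ContDiff.sum fun i _ => (hf1 i).mul (hf1 i)
  have hQ : ContDiff ℝ ∞ fun x => deriv (deriv p) (ℓ x) + -1 * (p (ℓ x) * (p (ℓ x) * p (ℓ x))) :=
    hP2.add (contDiff_const.mul (hP.mul (hP.mul hP)))
  have hG : ContDiff ℝ ∞ G := (hP.mul hsum).add ((hQ.mul hf).mul hf)
  have hHc : ∀ i, HasCompactSupport (H i) := fun i =>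
    ((hc1 i).mul_left (f := fun _ => (-4 : ℝ))).mul_left
  have hGc : HasCompactSupport G := by
    refine HasCompactSupport.add ?_ hc.mul_left
    refine HasCompactSupport.mul_left ?_
    refine HasCompactSupport.of_support_subset_isCompact
      (isCompact_iUnion fun i => (hc1 i).isCompact) fun x hx => ?_
    obtain ⟨i, _, hi⟩ := Finset.exists_ne_zero_of_sum_ne_zero hx
    exact Set.mem_iUnion.2 ⟨i, subset_tsupport _ (left_ne_zero_of_mul hi)⟩
  have hdH : ∀ i x, dirDeriv (e i) (H i) x =
      (p (ℓ x) * dirDeriv (e i₀) f x + deriv p (ℓ x) * f x) *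
        (-4 * dirDeriv (e i) (dirDeriv (e i) f) x) +
      ((p (ℓ x) * dirDeriv (e i₀) (dirDeriv (e i) f) x +
          (if i = i₀ then 1 else 0) * deriv p (ℓ x) * dirDeriv (e i₀) f x) +
        (deriv p (ℓ x) * dirDeriv (e i) f x +
          (if i = i₀ then 1 else 0) * deriv (deriv p) (ℓ x) * f x)) *
        (-4 * dirDeriv (e i) f x) := by
    intro i x
    rw [dirDeriv_mul ((hP.mul (hf1 i₀)).add (hP1.mul hf)) (contDiff_const.mul (hf1 i)),
      dirDeriv_const_mul _ (hf1 i), dirDeriv_add (hP.mul (hf1 i₀)) (hP1.mul hf),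
      dirDeriv_mul hP (hf1 i₀), dirDeriv_mul hP1 hf, dirDeriv_comp_clm hp, dirDeriv_comp_clm hp1,
      hℓ, dirDeriv_comm hf (v := e i) (w := e i₀)]
  have hdG : ∀ x, dirDeriv (e i₀) G x =
      p (ℓ x) * ∑ i, 2 * (dirDeriv (e i) f x * dirDeriv (e i₀) (dirDeriv (e i) f) x) +
      deriv p (ℓ x) * ∑ i, (dirDeriv (e i) f x * dirDeriv (e i) f x) +
      ((deriv (deriv p) (ℓ x) - p (ℓ x) ^ 3) * (2 * f x * dirDeriv (e i₀) f x) +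
        (deriv (deriv (deriv p)) (ℓ x) - 3 * p (ℓ x) ^ 2 * deriv p (ℓ x)) * f x ^ 2) := by
    intro x
    rw [dirDeriv_add (hP.mul hsum) ((hQ.mul hf).mul hf), dirDeriv_mul hP hsum,
      dirDeriv_sum fun i => (hf1 i).mul (hf1 i), dirDeriv_mul (hQ.mul hf) hf, dirDeriv_mul hQ hf,
      dirDeriv_add hP2 (contDiff_const.mul (hP.mul (hP.mul hP))),
      dirDeriv_const_mul _ (hP.mul (hP.mul hP)), dirDeriv_mul hP (hP.mul hP), dirDeriv_mul hP hP,
      dirDeriv_comp_clm hp, dirDeriv_comp_clm hp2, hℓ]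
    have : ∀ i, dirDeriv (e i₀) (fun x => dirDeriv (e i) f x * dirDeriv (e i) f x) x =
        2 * (dirDeriv (e i) f x * dirDeriv (e i₀) (dirDeriv (e i) f) x) := fun i => by
      rw [dirDeriv_mul (hf1 i) (hf1 i)]; ring
    simp_rw [this]
    simp only [if_true]
    ring
  -- all integrands are continuous with compact support
  have hint : ∀ {g : E → ℝ}, ContDiff ℝ ∞ g → Function.support g ⊆ tsupport f →
      Integrable g volume := fun {g} hg hs => hg.continuous.integrable_of_hasCompactSupport
    (HasCompactSupport.of_support_subset_isCompact hc.isCompact hs)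
  have hz : ∀ x ∉ tsupport f, f x = 0 ∧ (∀ i, dirDeriv (e i) f x = 0) ∧
      ∀ i, dirDeriv (e i) (dirDeriv (e i) f) x = 0 := by
    intro x hx
    have key : ∀ {g : E → ℝ} {v : E}, x ∉ tsupport g → x ∉ tsupport (dirDeriv v g) :=
      fun h h' => h (tsupport_fderiv_apply_subset ℝ _ h')
    exact ⟨image_eq_zero_of_notMem_tsupport hx,
      fun i => image_eq_zero_of_notMem_tsupport (key hx),
      fun i => image_eq_zero_of_notMem_tsupport (key (key hx))⟩
  have hL : Integrable (fun x => 2 * deriv p (ℓ x) * ∑ i, dirDeriv (e i) f x ^ 2 +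
        (2 * p (ℓ x) ^ 2 * deriv p (ℓ x) - 2 * deriv (deriv (deriv p)) (ℓ x)
          - deriv p (ℓ x) ^ 2) * f x ^ 2) volume := by
    refine hint (by fun_prop) (Function.support_subset_iff'.2 fun x hx => ?_)
    obtain ⟨h1, h2, h3⟩ := hz x hx
    simp [h1, h2]
  have hR : Integrable (fun x => ((∑ i, dirDeriv (e i) (dirDeriv (e i) f) x)
      - 2 * p (ℓ x) * dirDeriv (e i₀) f x + (p (ℓ x) ^ 2 - deriv p (ℓ x)) * f x) ^ 2) volume := by
    refine hint (by fun_prop) (Function.support_subset_iff'.2 fun x hx => ?_)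
    obtain ⟨h1, h2, h3⟩ := hz x hx
    simp [h1, h2, h3]
  have hHi : ∀ i, Integrable (dirDeriv (e i) (H i)) volume := fun i =>
    (contDiff_dirDeriv (hH i)).continuous.integrable_of_hasCompactSupport
      (hasCompactSupport_dirDeriv (hHc i))
  have hGi : Integrable (dirDeriv (e i₀) G) volume :=
    (contDiff_dirDeriv hG).continuous.integrable_of_hasCompactSupport
      (hasCompactSupport_dirDeriv hGc)
  -- Integrating the cross terms of the square by parts amounts to adding this divergence, whose
  -- integral vanishes. `H` trades the products of `Δf` with `p ∂f + p' f` for first order terms. `2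
  -- G` removes the mixed second derivatives left by `H` and reduces the `f ∂f` terms to a multiple
  -- of `f²`.
  have hdiv : ∫ x, ((∑ i, dirDeriv (e i) (H i) x) + 2 * dirDeriv (e i₀) G x) = 0 := by
    rw [integral_add (integrable_finsetSum _ fun i _ => hHi i) (hGi.const_mul 2),
      integral_finsetSum _ fun i _ => hHi i, integral_const_mul,
      integral_dirDeriv_eq_zero hG hGc]
    simp [fun i => integral_dirDeriv_eq_zero (v := e i) (hH i) (hHc i)]
  have hdi : Integrable (fun x => (∑ i, dirDeriv (e i) (H i) x) + 2 * dirDeriv (e i₀) G x)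
      volume := (integrable_finsetSum _ fun i _ => hHi i).add (hGi.const_mul 2)
  rw [← add_zero (∫ x, (2 * deriv p (ℓ x) * _ + _)), ← hdiv, ← integral_add hL hdi]
  refine integral_mono (hL.add hdi) hR fun x => ?_
  have hsq : ∀ i, dirDeriv (e i) f x * dirDeriv (e i) f x = dirDeriv (e i) f x ^ 2 := fun i =>
    (sq _).symm
  have hHsum : ∑ i, dirDeriv (e i) (H i) x =
      -4 * (p (ℓ x) * dirDeriv (e i₀) f x + deriv p (ℓ x) * f x) *
        (∑ i, dirDeriv (e i) (dirDeriv (e i) f) x)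
      - 4 * p (ℓ x) * (∑ i, dirDeriv (e i) f x * dirDeriv (e i₀) (dirDeriv (e i) f) x)
      - 4 * deriv p (ℓ x) * (∑ i, dirDeriv (e i) f x ^ 2)
      - 4 * deriv p (ℓ x) * dirDeriv (e i₀) f x ^ 2
      - 4 * deriv (deriv p) (ℓ x) * f x * dirDeriv (e i₀) f x := by
    have h1 : ∀ i, dirDeriv (e i) (H i) x =
      -4 * (p (ℓ x) * dirDeriv (e i₀) f x + deriv p (ℓ x) * f x) *
        dirDeriv (e i) (dirDeriv (e i) f) x
      - 4 * p (ℓ x) * (dirDeriv (e i) f x * dirDeriv (e i₀) (dirDeriv (e i) f) x)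
      - 4 * deriv p (ℓ x) * dirDeriv (e i) f x ^ 2
      - (if i = i₀ then 4 * (deriv p (ℓ x) * dirDeriv (e i₀) f x
          + deriv (deriv p) (ℓ x) * f x) * dirDeriv (e i) f x else 0) := by
      intro i
      rw [hdH]
      split_ifs <;> ring
    simp_rw [h1, Finset.sum_sub_distrib, ← Finset.mul_sum]
    rw [Finset.sum_ite_eq' Finset.univ i₀]
    simp only [Finset.mem_univ, if_true]
    ring
  simp only
  rw [hHsum, hdG]
  simp_rw [hsq, ← Finset.mul_sum]
  set A := ∑ i, dirDeriv (e i) (dirDeriv (e i) f) x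
  set B := ∑ i, dirDeriv (e i) f x ^ 2
  set S := dirDeriv (e i₀) f x
  set P := p (ℓ x)
  set P' := deriv p (ℓ x)
  have h1 : 0 ≤ P' * S ^ 2 := mul_nonneg (hp' _) (sq_nonneg _)
  -- The right integrand minus the left one minus the divergence equals `(A + P² f + P' f)² + (2 P S
  -- + P' f)² + 4 P' S²`. Monotonicity of `p` is needed only for the last term.
  nlinarith [sq_nonneg (A + P ^ 2 * f x + P' * f x), sq_nonneg (2 * P * S + P' * f x)]

end Carleman

/-! ### Carleman weights, and the inequality for smooth functions. -/

/-- The properties of a weight `exp φ` on the line, `φ' = lam * q`, that make it a Carleman weight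
for large `lam`. -/
structure IsCarlemanWeight (φ q : ℝ → ℝ) (lam K : ℝ) : Prop where
  contDiff : ContDiff ℝ ∞ φ
  contDiff_slope : ContDiff ℝ ∞ q
  deriv_eq : ∀ r, deriv φ r = lam * q r
  one_le : ∀ r, 1 ≤ q r
  deriv_nonneg : ∀ r, 0 ≤ deriv q r
  deriv_le_one : ∀ r, deriv q r ≤ 1
  abs_deriv_le : ∀ r, |deriv (deriv (deriv q)) r| ≤ K * deriv q r
  nonneg : 0 ≤ K
  le_lam : 1 + 2 * K ≤ lam

section Carleman

variable {E : Type*} [NormedAddCommGroup E] [NormedSpace ℝ E] [FiniteDimensional ℝ E]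
  [MeasureSpace E] [BorelSpace E] [(volume : Measure E).IsAddHaarMeasure]
  {ι : Type*} [Fintype ι] [DecidableEq ι] {e : ι → E} {i₀ : ι} {ℓ : E →L[ℝ] ℝ}
  {φ q : ℝ → ℝ} {lam K : ℝ}

/-- Undoes the conjugation in the gradient: the gradient of `exp(φ) v` differs from `exp(φ) ∇v` only
in the direction `i₀` in which the weight varies, so `|∇v|²` is recovered at the price of a zeroth
order term. -/
theorem sq_sum_add_single_le (a : ι → ℝ) (i₀ : ι) (c : ℝ) :
    ∑ i, a i ^ 2 ≤ 2 * ∑ i, (a i + (if i = i₀ then 1 else 0) * c) ^ 2 + 2 * c ^ 2 := by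
  have h : ∀ i, a i ^ 2 ≤ 2 * (a i + (if i = i₀ then 1 else 0) * c) ^ 2 +
      (if i = i₀ then 2 * c ^ 2 else 0) := by
    intro i
    split_ifs
    · nlinarith [sq_nonneg (a i + 2 * c)]
    · nlinarith [sq_nonneg (a i)]
  refine (Finset.sum_le_sum fun i _ => h i).trans (le_of_eq ?_)
  rw [Finset.sum_add_distrib, ← Finset.mul_sum, Finset.sum_ite_eq' Finset.univ i₀]
  simp

/-- This and the second order version ask only for `w' = w p`, because they serve two weights: `exp
φ` in the Carleman inequality and `exp (2φ)` in the test function for Caccioppoli's inequality. -/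
theorem dirDeriv_weight_mul (hℓ : ∀ i, ℓ (e i) = if i = i₀ then 1 else 0) {w p : ℝ → ℝ}
    (hw : ContDiff ℝ ∞ w) (hwp : ∀ r, deriv w r = w r * p r) {v : E → ℝ} (hv : ContDiff ℝ ∞ v)
    (i : ι) : dirDeriv (e i) (fun x => w (ℓ x) * v x) = fun x => w (ℓ x) *
      (dirDeriv (e i) v x + (if i = i₀ then 1 else 0) * (p (ℓ x) * v x)) := by
  ext x
  have hW : ContDiff ℝ ∞ fun x => w (ℓ x) := hw.comp ℓ.contDiff
  rw [dirDeriv_mul hW hv, dirDeriv_comp_clm hw, hℓ, hwp]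
  ring

theorem dirDeriv_dirDeriv_weight_mul (hℓ : ∀ i, ℓ (e i) = if i = i₀ then 1 else 0) {w p : ℝ → ℝ}
    (hw : ContDiff ℝ ∞ w) (hp : ContDiff ℝ ∞ p) (hwp : ∀ r, deriv w r = w r * p r) {v : E → ℝ}
    (hv : ContDiff ℝ ∞ v) (i : ι) (x : E) :
    dirDeriv (e i) (dirDeriv (e i) (fun x => w (ℓ x) * v x)) x = w (ℓ x) *
      (dirDeriv (e i) (dirDeriv (e i) v) x + (if i = i₀ then 1 else 0) *
        (2 * p (ℓ x) * dirDeriv (e i) v x + (p (ℓ x) ^ 2 + deriv p (ℓ x)) * v x)) := by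
  have hP : ContDiff ℝ ∞ fun x => p (ℓ x) := hp.comp ℓ.contDiff
  have hv1 : ContDiff ℝ ∞ (dirDeriv (e i) v) := contDiff_dirDeriv hv
  rw [dirDeriv_weight_mul hℓ hw hwp hv, dirDeriv_weight_mul hℓ hw hwp
    (hv1.add (contDiff_const.mul (hP.mul hv)))]
  beta_reduce
  rw [dirDeriv_add hv1 (contDiff_const.mul (hP.mul hv)), dirDeriv_const_mul _ (hP.mul hv), dirDeriv_mul hP hv, dirDeriv_comp_clm hp, hℓ]
  split_ifs <;> ring

/-- The Carleman inequality for smooth compactly supported functions. -/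
theorem carleman_smooth (hℓ : ∀ i, ℓ (e i) = if i = i₀ then 1 else 0)
    (hw : IsCarlemanWeight φ q lam K) {v : E → ℝ} (hv : ContDiff ℝ ∞ v)
    (hc : HasCompactSupport v) :
    ∫ x, deriv q (ℓ x) * Real.exp (2 * φ (ℓ x)) *
        (lam ^ 3 * v x ^ 2 + lam * ∑ i, dirDeriv (e i) v x ^ 2) ≤
      3 * ∫ x, Real.exp (2 * φ (ℓ x)) * (∑ i, dirDeriv (e i) (dirDeriv (e i) v) x) ^ 2 := by
  have hq := hw.contDiff_slope
  have hφ := hw.contDiff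
  have hq1 : ContDiff ℝ ∞ (deriv q) := (contDiff_infty_iff_deriv.1 hq).2
  have hq2 : ContDiff ℝ ∞ (deriv (deriv q)) := (contDiff_infty_iff_deriv.1 hq1).2
  have hq3 : ContDiff ℝ ∞ (deriv (deriv (deriv q))) := (contDiff_infty_iff_deriv.1 hq2).2
  have hlam : 1 ≤ lam := by linarith [hw.le_lam, hw.nonneg]
  have hd1 : deriv (fun r => lam * q r) = fun r => lam * deriv q r := by
    ext r; rw [deriv_const_mul _ (hq.differentiable (by simp) r)]
  have hd2 : deriv (fun r => lam * deriv q r) = fun r => lam * deriv (deriv q) r := by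
    ext r; rw [deriv_const_mul _ (hq1.differentiable (by simp) r)]
  have hd3 : deriv (fun r => lam * deriv (deriv q) r) =
      fun r => lam * deriv (deriv (deriv q)) r := by
    ext r; rw [deriv_const_mul _ (hq2.differentiable (by simp) r)]
  let w : ℝ → ℝ := fun r => Real.exp (φ r)
  have hwc : ContDiff ℝ ∞ w := hφ.exp
  have hW : ContDiff ℝ ∞ fun x => w (ℓ x) := hwc.comp ℓ.contDiff
  have hQ : ContDiff ℝ ∞ fun x => q (ℓ x) := hq.comp ℓ.contDiff
  have hQ1 : ContDiff ℝ ∞ fun x => deriv q (ℓ x) := hq1.comp ℓ.contDiff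
  have hΦ : ContDiff ℝ ∞ fun x => φ (ℓ x) := hφ.comp ℓ.contDiff
  have hQ3 : ContDiff ℝ ∞ fun x => deriv (deriv (deriv q)) (ℓ x) := hq3.comp ℓ.contDiff
  have hdw : ∀ r, deriv w r = w r * (lam * q r) := by
    intro r
    simp only [w]
    rw [← hw.deriv_eq, deriv_exp (hφ.differentiable (by simp) r)]
  have hw2 : ∀ r, w r ^ 2 = Real.exp (2 * φ r) := by
    intro r; simp only [w]; rw [← Real.exp_nat_mul]; norm_num
  let f : E → ℝ := fun x => w (ℓ x) * v x
  have hf : ContDiff ℝ ∞ f := hW.mul hv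
  have hfc : HasCompactSupport f := hc.mul_left
  have hfd : ∀ i, ContDiff ℝ ∞ (dirDeriv (e i) f) := fun i => contDiff_dirDeriv hf
  have hv1 : ∀ i, ContDiff ℝ ∞ (dirDeriv (e i) v) := fun i => contDiff_dirDeriv hv
  have hv2 : ∀ i, ContDiff ℝ ∞ (dirDeriv (e i) (dirDeriv (e i) v)) := fun i =>
    contDiff_dirDeriv (hv1 i)
  have hf1 : ∀ i, dirDeriv (e i) f = fun x => w (ℓ x) *
      (dirDeriv (e i) v x + (if i = i₀ then 1 else 0) * (lam * q (ℓ x) * v x)) :=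
    dirDeriv_weight_mul hℓ hwc hdw hv
  have hf2 := dirDeriv_dirDeriv_weight_mul hℓ hwc (contDiff_const.mul hq) hdw hv
  simp only [hd1] at hf2
  have key := carleman_conjugated (p := fun r => lam * q r) hℓ (contDiff_const.mul hq)
    (fun r => by rw [hd1]; exact mul_nonneg (by linarith) (hw.deriv_nonneg r)) hf hfc
  simp only [hd1, hd2, hd3] at key
  -- For `f = exp(φ) v`, the conjugated operator applied to `f` is `exp(φ) Δv`.
  have hR : ∀ x, ((∑ i, dirDeriv (e i) (dirDeriv (e i) f) x)
      - 2 * (lam * q (ℓ x)) * dirDeriv (e i₀) f x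
      + ((lam * q (ℓ x)) ^ 2 - lam * deriv q (ℓ x)) * f x) ^ 2 =
      Real.exp (2 * φ (ℓ x)) * (∑ i, dirDeriv (e i) (dirDeriv (e i) v) x) ^ 2 := by
    intro x
    simp only [f, hf2]
    change (_ - 2 * (lam * q (ℓ x)) * dirDeriv (e i₀) f x + _) ^ 2 = _
    rw [hf1, ← Finset.mul_sum, Finset.sum_add_distrib, ← hw2]
    simp only [ite_mul, one_mul, zero_mul, Finset.sum_ite_eq', Finset.mem_univ, if_true]
    ring
  simp_rw [hR] at key
  have hz : ∀ x ∉ tsupport v, v x = 0 ∧ (∀ i, dirDeriv (e i) v x = 0) := fun x hx =>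
    ⟨image_eq_zero_of_notMem_tsupport hx, fun i => image_eq_zero_of_notMem_tsupport
      fun h' => hx (tsupport_fderiv_apply_subset ℝ _ h')⟩
  have hint : ∀ {g : E → ℝ}, ContDiff ℝ ∞ g → (∀ x ∉ tsupport v, g x = 0) →
      Integrable g volume := fun {g} hg hs => hg.continuous.integrable_of_hasCompactSupport
    (HasCompactSupport.of_support_subset_isCompact hc.isCompact
      (Function.support_subset_iff'.2 hs))
  refine le_trans ?_ (mul_le_mul_of_nonneg_left key (by norm_num : (0 : ℝ) ≤ 3))
  rw [← integral_const_mul]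
  refine integral_mono (hint (by fun_prop) fun x hx => ?_)
    ((hint (by fun_prop) fun x hx => ?_).const_mul 3) fun x => ?_
  · obtain ⟨h1, h2⟩ := hz x hx
    simp [h1, h2]
  · obtain ⟨h1, h2⟩ := hz x hx
    simp [hf1, f, h1, h2]
  · have hsum : ∑ i, dirDeriv (e i) f x ^ 2 = w (ℓ x) ^ 2 *
        ∑ i, (dirDeriv (e i) v x + (if i = i₀ then 1 else 0) * (lam * (q (ℓ x) * v x))) ^ 2 := by
      rw [Finset.mul_sum]
      refine Finset.sum_congr rfl fun i _ => ?_
      rw [hf1]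
      ring
    have hS := sq_sum_add_single_le (fun i => dirDeriv (e i) v x) i₀ (lam * (q (ℓ x) * v x))
    simp only [hsum, ← hw2, f]
    set T := ∑ i, (dirDeriv (e i) v x + (if i = i₀ then 1 else 0) * (lam * (q (ℓ x) * v x))) ^ 2
    set S := ∑ i, dirDeriv (e i) v x ^ 2
    set Q := q (ℓ x)
    set Q' := deriv q (ℓ x)
    set Q3 := deriv (deriv (deriv q)) (ℓ x)
    set y := v x
    have hQ1 : 1 ≤ Q := hw.one_le _
    have hQ0 : 0 ≤ Q' := hw.deriv_nonneg _
    have hQ'1 : Q' ≤ 1 := hw.deriv_le_one _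
    have hQ3 : Q3 ≤ K * Q' := (le_abs_self _).trans (hw.abs_deriv_le _)
    have hK := hw.nonneg
    have hlam2 := hw.le_lam
    have hQsq : 1 ≤ Q ^ 2 := one_le_pow₀ hQ1
    -- the zeroth order coefficient
    have hcoef : lam ^ 3 * Q ^ 2 * Q' ≤ 2 * (lam * Q) ^ 2 * (lam * Q') - 2 * (lam * Q3)
        - (lam * Q') ^ 2 := by
      have h1 : lam * Q3 ≤ lam * (K * Q') := by gcongr
      have h2 : (lam * Q') ^ 2 ≤ lam ^ 2 * Q' := by
        have : Q' ^ 2 ≤ Q' := by nlinarith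
        nlinarith [sq_nonneg lam]
      -- The condition `1 + 2K ≤ lam` makes the negative terms use up at most one of the two copies
      -- of `lam³ q² q'`; the control of `q'''` by `q'` is what gives them all the factor `q'`.
      have h3 : (2 * lam * K + lam ^ 2) * Q' ≤ lam ^ 3 * Q ^ 2 * Q' := by
        refine mul_le_mul_of_nonneg_right ?_ hQ0
        have h4 : 2 * lam * K + lam ^ 2 ≤ lam ^ 3 := by
          have h5 : 2 * K + lam ≤ lam ^ 2 := by nlinarith
          nlinarith
        nlinarith [pow_pos (by linarith : 0 < lam) 3]
      nlinarith
    -- The constant 3 is `1 + 2`: one copy of `lam³ q² q' v²` dominates the zeroth order term, since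
    -- `q ≥ 1`, and two are spent on recovering `∇v` from the gradient of `exp(φ) v`.
    have hlhs : Q' * (lam ^ 3 * y ^ 2 + lam * S) ≤
        3 * (2 * (lam * Q') * T + lam ^ 3 * Q ^ 2 * Q' * y ^ 2) := by
      have h1 : Q' * lam ^ 3 * y ^ 2 ≤ Q' * lam ^ 3 * y ^ 2 * Q ^ 2 := le_mul_of_one_le_right
        (by positivity) hQsq
      have h2 : Q' * lam * S ≤ Q' * lam * (2 * T + 2 * (lam * (Q * y)) ^ 2) := by gcongr
      have h3 : 0 ≤ Q' * lam * T := mul_nonneg (by positivity)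
        (Finset.sum_nonneg fun i _ => sq_nonneg _)
      nlinarith
    calc Q' * w (ℓ x) ^ 2 * (lam ^ 3 * y ^ 2 + lam * S)
        = w (ℓ x) ^ 2 * (Q' * (lam ^ 3 * y ^ 2 + lam * S)) := by ring
      _ ≤ w (ℓ x) ^ 2 * (3 * (2 * (lam * Q') * T + lam ^ 3 * Q ^ 2 * Q' * y ^ 2)) := by gcongr
      _ ≤ w (ℓ x) ^ 2 * (3 * (2 * (lam * Q') * T + (2 * (lam * Q) ^ 2 * (lam * Q')
          - 2 * (lam * Q3) - (lam * Q') ^ 2) * y ^ 2)) := by gcongr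
      _ = _ := by ring

end Carleman

/-! ### Passage to the limit: Carleman and energy identities in `H²_loc`. -/

section Limits

variable {E : Type*} [NormedAddCommGroup E] [NormedSpace ℝ E] [FiniteDimensional ℝ E]
  [MeasureSpace E] [BorelSpace E] [(volume : Measure E).IsAddHaarMeasure]
  {ι : Type*} [Fintype ι] [DecidableEq ι] {e : ι → E} {i₀ : ι} {ℓ : E →L[ℝ] ℝ}
  {φ q : ℝ → ℝ} {lam K : ℝ} {a : E → ℝ} {a₁ a₂ : ι → E → ℝ}

/-- Splits the weighted quadratic form into integrals of products of two `L²_loc` functions, the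
shape required by `L2locTendsto.tendsto_integral_mul`. -/
theorem integral_weight_mul_eq {m : E → ℝ} (hm : Continuous m) {S : Set E} (hS : IsCompact S)
    (c d : ℝ) {X : E → ℝ} {Y : ι → E → ℝ} (hX : IsL2loc X) (hY : ∀ i, IsL2loc (Y i))
    (hX0 : ∀ x ∉ S, X x = 0) (hY0 : ∀ i, ∀ x ∉ S, Y i x = 0) :
    ∫ x, m x * (c * X x ^ 2 + d * ∑ i, Y i x ^ 2) =
      c * (∫ x, (m x * X x) * X x) + d * ∑ i, ∫ x, (m x * Y i x) * Y i x := by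
  have h1 : Integrable (fun x => (m x * X x) * X x) volume :=
    (hX.continuous_mul hm).integrable_mul hX hS fun x hx => by simp [hX0 x hx]
  have h2 : ∀ i, Integrable (fun x => (m x * Y i x) * Y i x) volume := fun i =>
    ((hY i).continuous_mul hm).integrable_mul (hY i) hS fun x hx => by simp [hY0 i x hx]
  rw [← integral_finsetSum _ fun i _ => h2 i, ← integral_const_mul, ← integral_const_mul,
    ← integral_add (h1.const_mul c) ((integrable_finsetSum _ fun i _ => h2 i).const_mul d)]
  congr 1
  ext x
  rw [mul_add, Finset.mul_sum, Finset.mul_sum, Finset.mul_sum]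
  congr 1
  · ring
  · exact Finset.sum_congr rfl fun i _ => by ring

/-- The Carleman inequality for the product of an `H²_loc` function with a cutoff. -/
theorem IsH2Limit.carleman (h : IsH2Limit e a a₁ a₂)
    (hℓ : ∀ i, ℓ (e i) = if i = i₀ then 1 else 0)
    (hw : IsCarlemanWeight φ q lam K) {χ : E → ℝ} (hχ : ContDiff ℝ ∞ χ)
    (hc : HasCompactSupport χ) :
    ∫ x, deriv q (ℓ x) * Real.exp (2 * φ (ℓ x)) *
        (lam ^ 3 * (χ x * a x) ^ 2 + lam * ∑ i, (χ x * a₁ i x + dirDeriv (e i) χ x * a x) ^ 2) ≤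
      3 * ∫ x, Real.exp (2 * φ (ℓ x)) * (∑ i, (χ x * a₂ i x + (2 * dirDeriv (e i) χ x * a₁ i x +
        dirDeriv (e i) (dirDeriv (e i) χ) x * a x))) ^ 2 := by
  obtain ⟨s, hs, hs0, hs1, hs2⟩ := h.approx
  have hq1 : ContDiff ℝ ∞ (deriv q) := (contDiff_infty_iff_deriv.1 hw.contDiff_slope).2
  have hE : Continuous fun x => Real.exp (2 * φ (ℓ x)) := by
    have := hw.contDiff.continuous
    fun_prop
  have hm : Continuous fun x => deriv q (ℓ x) * Real.exp (2 * φ (ℓ x)) := by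
    have := hq1.continuous
    fun_prop
  have hχ1 : ∀ i, ContDiff ℝ ∞ (dirDeriv (e i) χ) := fun i => contDiff_dirDeriv hχ
  have hχ2 : ∀ i, ContDiff ℝ ∞ (dirDeriv (e i) (dirDeriv (e i) χ)) := fun i =>
    contDiff_dirDeriv (hχ1 i)
  have hz : ∀ x ∉ tsupport χ, χ x = 0 ∧ (∀ i, dirDeriv (e i) χ x = 0) ∧
      ∀ i, dirDeriv (e i) (dirDeriv (e i) χ) x = 0 := by
    intro x hx
    have key : ∀ {g : E → ℝ} {v : E}, x ∉ tsupport g → x ∉ tsupport (dirDeriv v g) :=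
      fun h h' => h (tsupport_fderiv_apply_subset ℝ _ h')
    exact ⟨image_eq_zero_of_notMem_tsupport hx,
      fun i => image_eq_zero_of_notMem_tsupport (key hx),
      fun i => image_eq_zero_of_notMem_tsupport (key (key hx))⟩
  have hsd : ∀ i k, ContDiff ℝ ∞ (dirDeriv (e i) (s k)) := fun i k => contDiff_dirDeriv (hs k)
  have hsdd : ∀ i k, ContDiff ℝ ∞ (dirDeriv (e i) (dirDeriv (e i) (s k))) := fun i k =>
    contDiff_dirDeriv (hsd i k)
  -- the three functions in play, for the approximants and for the limit
  have hX : ∀ k, IsL2loc fun x => χ x * s k x := fun k =>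
    (isL2loc_of_continuous (hs k).continuous).continuous_mul hχ.continuous
  have hX' : IsL2loc fun x => χ x * a x := h.mem.continuous_mul hχ.continuous
  have hXt : L2locTendsto (fun k x => χ x * s k x) fun x => χ x * a x :=
    hs0.continuous_mul hχ.continuous
  have hY : ∀ i k, IsL2loc fun x => χ x * dirDeriv (e i) (s k) x + dirDeriv (e i) χ x * s k x :=
    fun i k => ((isL2loc_of_continuous (hsd i k).continuous).continuous_mul hχ.continuous).add
      ((isL2loc_of_continuous (hs k).continuous).continuous_mul (hχ1 i).continuous)
  have hY' : ∀ i, IsL2loc fun x => χ x * a₁ i x + dirDeriv (e i) χ x * a x := fun i =>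
    ((h.mem₁ i).continuous_mul hχ.continuous).add (h.mem.continuous_mul (hχ1 i).continuous)
  have hYt : ∀ i, L2locTendsto
      (fun k x => χ x * dirDeriv (e i) (s k) x + dirDeriv (e i) χ x * s k x)
      fun x => χ x * a₁ i x + dirDeriv (e i) χ x * a x := fun i =>
    L2locTendsto.add
      (fun k => (isL2loc_of_continuous (hsd i k).continuous).continuous_mul hχ.continuous)
      (fun k => (isL2loc_of_continuous (hs k).continuous).continuous_mul (hχ1 i).continuous)
      ((h.mem₁ i).continuous_mul hχ.continuous) (h.mem.continuous_mul (hχ1 i).continuous)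
      ((hs1 i).continuous_mul hχ.continuous) (hs0.continuous_mul (hχ1 i).continuous)
  have h2χ : ∀ i, Continuous fun x => 2 * dirDeriv (e i) χ x := fun i =>
    continuous_const.mul (hχ1 i).continuous
  have hT : ∀ i k, IsL2loc fun x => 2 * dirDeriv (e i) χ x * dirDeriv (e i) (s k) x +
      dirDeriv (e i) (dirDeriv (e i) χ) x * s k x := fun i k =>
    ((isL2loc_of_continuous (hsd i k).continuous).continuous_mul (h2χ i)).add
      ((isL2loc_of_continuous (hs k).continuous).continuous_mul (hχ2 i).continuous)
  have hT' : ∀ i, IsL2loc fun x => 2 * dirDeriv (e i) χ x * a₁ i x +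
      dirDeriv (e i) (dirDeriv (e i) χ) x * a x := fun i =>
    ((h.mem₁ i).continuous_mul (h2χ i)).add (h.mem.continuous_mul (hχ2 i).continuous)
  have hTt : ∀ i, L2locTendsto (fun k x => 2 * dirDeriv (e i) χ x * dirDeriv (e i) (s k) x +
      dirDeriv (e i) (dirDeriv (e i) χ) x * s k x) fun x => 2 * dirDeriv (e i) χ x * a₁ i x +
      dirDeriv (e i) (dirDeriv (e i) χ) x * a x := fun i =>
    L2locTendsto.add
      (fun k => (isL2loc_of_continuous (hsd i k).continuous).continuous_mul (h2χ i))
      (fun k => (isL2loc_of_continuous (hs k).continuous).continuous_mul (hχ2 i).continuous)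
      ((h.mem₁ i).continuous_mul (h2χ i)) (h.mem.continuous_mul (hχ2 i).continuous)
      ((hs1 i).continuous_mul (h2χ i)) (hs0.continuous_mul (hχ2 i).continuous)
  have hZi : ∀ i k, IsL2loc fun x => χ x * dirDeriv (e i) (dirDeriv (e i) (s k)) x +
      (2 * dirDeriv (e i) χ x * dirDeriv (e i) (s k) x +
        dirDeriv (e i) (dirDeriv (e i) χ) x * s k x) := fun i k =>
    ((isL2loc_of_continuous (hsdd i k).continuous).continuous_mul hχ.continuous).add (hT i k)
  have hZi' : ∀ i, IsL2loc fun x => χ x * a₂ i x + (2 * dirDeriv (e i) χ x * a₁ i x +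
      dirDeriv (e i) (dirDeriv (e i) χ) x * a x) := fun i =>
    ((h.mem₂ i).continuous_mul hχ.continuous).add (hT' i)
  have hZ := fun k => isL2loc_sum fun i => hZi i k
  have hZ' := isL2loc_sum hZi'
  have hZt := l2locTendsto_sum hZi hZi' fun i => L2locTendsto.add
      (fun k => (isL2loc_of_continuous (hsdd i k).continuous).continuous_mul hχ.continuous)
      (hT i) ((h.mem₂ i).continuous_mul hχ.continuous) (hT' i)
      ((hs2 i).continuous_mul hχ.continuous) (hTt i)
  -- the inequality for the approximants
  have hd1 : ∀ i k, dirDeriv (e i) (fun x => χ x * s k x) =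
      fun x => χ x * dirDeriv (e i) (s k) x + dirDeriv (e i) χ x * s k x := fun i k =>
    funext fun x => dirDeriv_mul hχ (hs k) x
  have hd2 : ∀ i k x, dirDeriv (e i) (fun x => χ x * dirDeriv (e i) (s k) x +
      dirDeriv (e i) χ x * s k x) x = χ x * dirDeriv (e i) (dirDeriv (e i) (s k)) x +
      (2 * dirDeriv (e i) χ x * dirDeriv (e i) (s k) x +
        dirDeriv (e i) (dirDeriv (e i) χ) x * s k x) := by
    intro i k x
    rw [dirDeriv_add (hχ.mul (hsd i k)) ((hχ1 i).mul (hs k)), dirDeriv_mul hχ (hsd i k),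
      dirDeriv_mul (hχ1 i) (hs k)]
    ring
  have key : ∀ k, _ := fun k => carleman_smooth hℓ hw (hχ.mul (hs k)) hc.mul_right
  simp only [hd1, hd2] at key
  have hcs : IsCompact (tsupport χ) := hc
  have hrhs : ∀ Z : E → ℝ, ∫ x, Real.exp (2 * φ (ℓ x)) * Z x ^ 2 =
      ∫ x, Real.exp (2 * φ (ℓ x)) * Z x * Z x := fun Z => by
    congr 1; ext x; ring
  rw [integral_weight_mul_eq hm hcs _ _ hX' hY' (fun x hx => by simp [(hz x hx).1])
    (fun i x hx => by simp [(hz x hx).1, (hz x hx).2.1]), hrhs]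
  have key2 : ∀ k, _ := fun k => by
    have := key k
    rw [integral_weight_mul_eq hm hcs _ _ (hX k) (fun i => hY i k)
      (fun x hx => by simp [(hz x hx).1])
      (fun i x hx => by simp [(hz x hx).1, (hz x hx).2.1]), hrhs] at this
    exact this
  refine le_of_tendsto_of_tendsto' (b := atTop) ?_ ?_ key2
  · refine Tendsto.add (Tendsto.const_mul _ ?_)
      (Tendsto.const_mul _ (tendsto_finsetSum _ fun i _ => ?_))
    · exact L2locTendsto.tendsto_integral_mul (fun k => (hX k).continuous_mul hm) hX
        (hX'.continuous_mul hm) hX' (hXt.continuous_mul hm) hXt hcs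
        (fun k x hx => by simp [(hz x hx).1]) fun x hx => by simp [(hz x hx).1]
    · exact L2locTendsto.tendsto_integral_mul (fun k => (hY i k).continuous_mul hm) (hY i)
        ((hY' i).continuous_mul hm) (hY' i) ((hYt i).continuous_mul hm) (hYt i) hcs
        (fun k x hx => by simp [(hz x hx).1, (hz x hx).2.1])
        fun x hx => by simp [(hz x hx).1, (hz x hx).2.1]
  · refine Tendsto.const_mul _ ?_
    exact L2locTendsto.tendsto_integral_mul (fun k => (hZ k).continuous_mul hE) hZ
      (hZ'.continuous_mul hE) hZ' (hZt.continuous_mul hE) hZt hcs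
      (fun k x hx => by simp [(hz x hx).1, (hz x hx).2.1, (hz x hx).2.2])
      fun x hx => by simp [(hz x hx).1, (hz x hx).2.1, (hz x hx).2.2]

/-- The localized energy identity `∫ g |∂ᵢa|² = ½ ∫ (∂ᵢ²g) a² - ∫ g a ∂ᵢ²a`. -/
theorem IsH2Limit.energy (h : IsH2Limit e a a₁ a₂) {g : E → ℝ} (hg : ContDiff ℝ ∞ g)
    (hc : HasCompactSupport g) (i : ι) :
    ∫ x, g x * a₁ i x * a₁ i x = 1 / 2 * (∫ x, dirDeriv (e i) (dirDeriv (e i) g) x * a x * a x) -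
      ∫ x, g x * a x * a₂ i x := by
  obtain ⟨s, hs, hs0, hs1, hs2⟩ := h.approx
  have hg1 : ContDiff ℝ ∞ (dirDeriv (e i) g) := contDiff_dirDeriv hg
  have hg2 : ContDiff ℝ ∞ (dirDeriv (e i) (dirDeriv (e i) g)) := contDiff_dirDeriv hg1
  have hcg1 : HasCompactSupport (dirDeriv (e i) g) := hasCompactSupport_dirDeriv hc
  have hcg2 : HasCompactSupport (dirDeriv (e i) (dirDeriv (e i) g)) :=
    hasCompactSupport_dirDeriv hcg1
  have hsd : ∀ k, ContDiff ℝ ∞ (dirDeriv (e i) (s k)) := fun k => contDiff_dirDeriv (hs k)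
  have hsdd : ∀ k, ContDiff ℝ ∞ (dirDeriv (e i) (dirDeriv (e i) (s k))) := fun k =>
    contDiff_dirDeriv (hsd k)
  have key : ∀ k, ∫ x, g x * dirDeriv (e i) (s k) x * dirDeriv (e i) (s k) x =
      1 / 2 * (∫ x, dirDeriv (e i) (dirDeriv (e i) g) x * s k x * s k x) -
      ∫ x, g x * s k x * dirDeriv (e i) (dirDeriv (e i) (s k)) x := by
    intro k
    -- The derivative of `g s ∂s - ½ (∂g) s²` is `g (∂s)² + g s ∂²s - ½ (∂²g) s²`, the terms in
    -- `(∂g) s ∂s` cancelling; its zero integral is the identity for the approximants.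
    have hF : ContDiff ℝ ∞ fun x => g x * (s k x * dirDeriv (e i) (s k) x) +
        -(1 / 2) * (dirDeriv (e i) g x * (s k x * s k x)) :=
      (hg.mul ((hs k).mul (hsd k))).add (contDiff_const.mul (hg1.mul ((hs k).mul (hs k))))
    have hFc : HasCompactSupport fun x => g x * (s k x * dirDeriv (e i) (s k) x) +
        -(1 / 2) * (dirDeriv (e i) g x * (s k x * s k x)) :=
      (hc.mul_right).add ((hcg1.mul_right).mul_left)
    have h0 := integral_dirDeriv_eq_zero (v := e i) hF hFc
    have hd : ∀ x, dirDeriv (e i) (fun x => g x * (s k x * dirDeriv (e i) (s k) x) +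
        -(1 / 2) * (dirDeriv (e i) g x * (s k x * s k x))) x =
        (g x * dirDeriv (e i) (s k) x * dirDeriv (e i) (s k) x +
        g x * s k x * dirDeriv (e i) (dirDeriv (e i) (s k)) x) -
        1 / 2 * (dirDeriv (e i) (dirDeriv (e i) g) x * s k x * s k x) := by
      intro x
      rw [dirDeriv_add (hg.mul ((hs k).mul (hsd k)))
        (contDiff_const.mul (hg1.mul ((hs k).mul (hs k)))), dirDeriv_mul hg ((hs k).mul (hsd k)),
        dirDeriv_mul (hs k) (hsd k), dirDeriv_const_mul _ (hg1.mul ((hs k).mul (hs k))),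
        dirDeriv_mul hg1 ((hs k).mul (hs k)), dirDeriv_mul (hs k) (hs k)]
      ring
    simp_rw [hd] at h0
    have i1 : Integrable (fun x => g x * dirDeriv (e i) (s k) x * dirDeriv (e i) (s k) x) volume :=
      ((hg.mul (hsd k)).mul (hsd k)).continuous.integrable_of_hasCompactSupport
        hc.mul_right.mul_right
    have i2 : Integrable (fun x => g x * s k x * dirDeriv (e i) (dirDeriv (e i) (s k)) x) volume :=
      ((hg.mul (hs k)).mul (hsdd k)).continuous.integrable_of_hasCompactSupport
        hc.mul_right.mul_right
    have i3 : Integrable (fun x => dirDeriv (e i) (dirDeriv (e i) g) x * s k x * s k x) volume :=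
      ((hg2.mul (hs k)).mul (hs k)).continuous.integrable_of_hasCompactSupport
        hcg2.mul_right.mul_right
    have i12 : Integrable (fun x => g x * dirDeriv (e i) (s k) x * dirDeriv (e i) (s k) x +
        g x * s k x * dirDeriv (e i) (dirDeriv (e i) (s k)) x) volume := i1.add i2
    rw [integral_sub i12 (i3.const_mul _), integral_add i1 i2, integral_const_mul] at h0
    linarith
  have lim : ∀ {γ : E → ℝ} {s t : ℕ → E → ℝ} {b c : E → ℝ}, ContDiff ℝ ∞ γ →
      HasCompactSupport γ → (∀ k, ContDiff ℝ ∞ (s k)) → (∀ k, ContDiff ℝ ∞ (t k)) → IsL2loc b →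
      IsL2loc c → L2locTendsto s b → L2locTendsto t c →
      Tendsto (fun k => ∫ x, γ x * s k x * t k x) atTop (𝓝 (∫ x, γ x * b x * c x)) := by
    intro γ s t b c hγ hγc hs ht hb hc hsb htc
    exact L2locTendsto.tendsto_integral_mul
      (fun k => (isL2loc_of_continuous (hs k).continuous).continuous_mul hγ.continuous)
      (fun k => isL2loc_of_continuous (ht k).continuous) (hb.continuous_mul hγ.continuous) hc
      (hsb.continuous_mul hγ.continuous) htc hγc
      (fun k x hx => by simp [image_eq_zero_of_notMem_tsupport hx])
      fun x hx => by simp [image_eq_zero_of_notMem_tsupport hx]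
  refine tendsto_nhds_unique
    (lim hg hc hsd hsd (h.mem₁ i) (h.mem₁ i) (hs1 i) (hs1 i)) ?_
  simp_rw [key]
  exact ((lim hg2 hcg2 hs hs h.mem h.mem hs0 hs0).const_mul _).sub
    (lim hg hc hs hsdd h.mem (h.mem₂ i) hs0 (hs2 i))

end Limits

/-! ### Cutoff errors in the Carleman inequality. -/

section Estimates

variable {E : Type*} [NormedAddCommGroup E] [NormedSpace ℝ E] [FiniteDimensional ℝ E]
  [MeasureSpace E] [BorelSpace E] [(volume : Measure E).IsAddHaarMeasure]
  {ι : Type*} [Fintype ι] [DecidableEq ι] {e : ι → E} {i₀ : ι} {ℓ : E →L[ℝ] ℝ}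
  {φ q : ℝ → ℝ} {lam K : ℝ} {a b : E → ℝ} {a₁ a₂ b₁ b₂ : ι → E → ℝ}

theorem IsL2loc.locallyIntegrable_mul {f g : E → ℝ} (hf : IsL2loc f) (hg : IsL2loc g) :
    LocallyIntegrable (fun x => f x * g x) volume :=
  locallyIntegrable_iff.2 fun K hK => (hf K hK).integrable_mul (hg K hK)

theorem IsL2loc.locallyIntegrable_sq {f : E → ℝ} (hf : IsL2loc f) :
    LocallyIntegrable (fun x => f x ^ 2) volume := by
  simpa only [sq] using hf.locallyIntegrable_mul hf

theorem LocallyIntegrable.finset_sum {f : ι → E → ℝ} (hf : ∀ i, LocallyIntegrable (f i) volume) :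
    LocallyIntegrable (fun x => ∑ i, f i x) volume :=
  locallyIntegrable_iff.2 fun K hK => integrable_finsetSum _ fun i _ =>
    locallyIntegrable_iff.1 (hf i) K hK

theorem LocallyIntegrable.integrable_mul_of_hasCompactSupport {c f : E → ℝ}
    (hf : LocallyIntegrable f volume) (hc : Continuous c) (hcs : HasCompactSupport c) :
    Integrable (fun x => c x * f x) volume :=
  hf.integrable_smul_left_of_hasCompactSupport hc hcs

/-- The Carleman inequality with the terms that fall on the cutoff `χ` estimated by a second
cutoff `κ`. -/
theorem IsH2Limit.carleman_cutoff (h : IsH2Limit e a a₁ a₂)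
    (hℓ : ∀ i, ℓ (e i) = if i = i₀ then 1 else 0)
    (hw : IsCarlemanWeight φ q lam K) {χ κ : E → ℝ} (hχ : ContDiff ℝ ∞ χ)
    (hc : HasCompactSupport χ) (hκ : Continuous κ) (hκc : HasCompactSupport κ) {δ : ℝ}
    (h₁ : ∀ x, ∑ i, dirDeriv (e i) χ x ^ 2 ≤ δ * κ x)
    (h₂ : ∀ x, (∑ i, dirDeriv (e i) (dirDeriv (e i) χ) x) ^ 2 ≤ δ * κ x) :
    ∫ x, deriv q (ℓ x) * Real.exp (2 * φ (ℓ x)) * χ x ^ 2 *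
        (lam ^ 3 * a x ^ 2 + lam / 2 * ∑ i, a₁ i x ^ 2) ≤
      9 * (∫ x, Real.exp (2 * φ (ℓ x)) * χ x ^ 2 * (∑ i, a₂ i x) ^ 2) +
      δ * ∫ x, Real.exp (2 * φ (ℓ x)) * κ x * ((lam + 9) * a x ^ 2 + 36 * ∑ i, a₁ i x ^ 2) := by
  have hlam : 1 ≤ lam := by linarith [hw.le_lam, hw.nonneg]
  have hq1 : ContDiff ℝ ∞ (deriv q) := (contDiff_infty_iff_deriv.1 hw.contDiff_slope).2
  have hE : Continuous fun x => Real.exp (2 * φ (ℓ x)) := by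
    have := hw.contDiff.continuous
    fun_prop
  have hm : Continuous fun x => deriv q (ℓ x) * Real.exp (2 * φ (ℓ x)) := by
    have := hq1.continuous
    fun_prop
  have hχs : HasCompactSupport fun x => χ x ^ 2 := by
    simp_rw [sq]; exact hc.mul_left
  have hχ1 : ∀ i, ContDiff ℝ ∞ (dirDeriv (e i) χ) := fun i => contDiff_dirDeriv hχ
  have hχ2 : ∀ i, ContDiff ℝ ∞ (dirDeriv (e i) (dirDeriv (e i) χ)) := fun i =>
    contDiff_dirDeriv (hχ1 i)
  have l0 := h.mem.locallyIntegrable_sq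
  have l1 := LocallyIntegrable.finset_sum fun i => (h.mem₁ i).locallyIntegrable_sq
  have l2 := (isL2loc_sum h.mem₂).locallyIntegrable_sq
  have hcs : IsCompact (tsupport χ) := hc
  have hz : ∀ x ∉ tsupport χ, χ x = 0 ∧ (∀ i, dirDeriv (e i) χ x = 0) ∧
      ∀ i, dirDeriv (e i) (dirDeriv (e i) χ) x = 0 := by
    intro x hx
    have key : ∀ {g : E → ℝ} {v : E}, x ∉ tsupport g → x ∉ tsupport (dirDeriv v g) :=
      fun h h' => h (tsupport_fderiv_apply_subset ℝ _ h')
    exact ⟨image_eq_zero_of_notMem_tsupport hx,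
      fun i => image_eq_zero_of_notMem_tsupport (key hx),
      fun i => image_eq_zero_of_notMem_tsupport (key (key hx))⟩
  have key := h.carleman hℓ hw hχ hc
  -- integrability of the two sides of the Carleman inequality
  have hY : ∀ i, IsL2loc fun x => χ x * a₁ i x + dirDeriv (e i) χ x * a x := fun i =>
    ((h.mem₁ i).continuous_mul hχ.continuous).add (h.mem.continuous_mul (hχ1 i).continuous)
  have hZ := isL2loc_sum fun i => ((h.mem₂ i).continuous_mul hχ.continuous).add
    (((h.mem₁ i).continuous_mul (continuous_const.mul (hχ1 i).continuous :
      Continuous fun x => 2 * dirDeriv (e i) χ x)).add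
      (h.mem.continuous_mul (hχ2 i).continuous))
  have hL : Integrable (fun x => deriv q (ℓ x) * Real.exp (2 * φ (ℓ x)) *
      (lam ^ 3 * (χ x * a x) ^ 2 +
        lam * ∑ i, (χ x * a₁ i x + dirDeriv (e i) χ x * a x) ^ 2)) volume := by
    have := (((h.mem.continuous_mul hχ.continuous).locallyIntegrable_sq.smul (lam ^ 3)).add
      ((LocallyIntegrable.finset_sum fun i => (hY i).locallyIntegrable_sq).smul lam))
    rw [locallyIntegrable_iff] at this
    rw [← integrableOn_iff_integrable_of_support_subset (s := tsupport χ)]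
    · exact (this _ hcs).continuousOn_mul hm.continuousOn hcs
    · refine Function.support_subset_iff'.2 fun x hx => ?_
      simp [(hz x hx).1, (hz x hx).2.1]
  have hR : Integrable (fun x => Real.exp (2 * φ (ℓ x)) * (∑ i, (χ x * a₂ i x +
      (2 * dirDeriv (e i) χ x * a₁ i x + dirDeriv (e i) (dirDeriv (e i) χ) x * a x))) ^ 2)
      volume := by
    have := hZ.locallyIntegrable_sq
    rw [locallyIntegrable_iff] at this
    rw [← integrableOn_iff_integrable_of_support_subset (s := tsupport χ)]
    · exact (this _ hcs).continuousOn_mul hE.continuousOn hcs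
    · refine Function.support_subset_iff'.2 fun x hx => ?_
      simp [(hz x hx).1, (hz x hx).2.1, (hz x hx).2.2]
  have i1 : Integrable (fun x => deriv q (ℓ x) * Real.exp (2 * φ (ℓ x)) * χ x ^ 2 *
      (lam ^ 3 * a x ^ 2 + lam / 2 * ∑ i, a₁ i x ^ 2)) volume :=
    LocallyIntegrable.integrable_mul_of_hasCompactSupport
      ((l0.smul (lam ^ 3)).add (l1.smul (lam / 2))) (hm.mul (hχ.continuous.pow 2)) hχs.mul_left
  have i2 : Integrable (fun x => Real.exp (2 * φ (ℓ x)) * χ x ^ 2 * (∑ i, a₂ i x) ^ 2) volume :=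
    LocallyIntegrable.integrable_mul_of_hasCompactSupport l2 (hE.mul (hχ.continuous.pow 2))
      hχs.mul_left
  have i3 : Integrable (fun x => Real.exp (2 * φ (ℓ x)) * κ x * (lam * a x ^ 2)) volume :=
    LocallyIntegrable.integrable_mul_of_hasCompactSupport (l0.smul lam) (hE.mul hκ) hκc.mul_left
  have i4 : Integrable (fun x => Real.exp (2 * φ (ℓ x)) * κ x *
      (9 * a x ^ 2 + 36 * ∑ i, a₁ i x ^ 2)) volume :=
    LocallyIntegrable.integrable_mul_of_hasCompactSupport
      ((l0.smul (9 : ℝ)).add (l1.smul (36 : ℝ))) (hE.mul hκ) hκc.mul_left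
  -- The gradient of `χ a` controls half of `χ² |∇a|²`, up to `|∇χ|² a²`. Since `q' ≤ 1`, the error
  -- needs no factor `q'`; it contributes the `lam` in the coefficient `lam + 9`.
  have m1 : ∫ x, deriv q (ℓ x) * Real.exp (2 * φ (ℓ x)) * χ x ^ 2 *
        (lam ^ 3 * a x ^ 2 + lam / 2 * ∑ i, a₁ i x ^ 2) ≤
      (∫ x, deriv q (ℓ x) * Real.exp (2 * φ (ℓ x)) * (lam ^ 3 * (χ x * a x) ^ 2 +
        lam * ∑ i, (χ x * a₁ i x + dirDeriv (e i) χ x * a x) ^ 2)) +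
      δ * ∫ x, Real.exp (2 * φ (ℓ x)) * κ x * (lam * a x ^ 2) := by
    rw [← integral_const_mul, ← integral_add hL (i3.const_mul δ)]
    refine integral_mono i1 (hL.add (i3.const_mul δ)) fun x => ?_
    have hs : 1 / 2 * (χ x ^ 2 * ∑ i, a₁ i x ^ 2) ≤
        ∑ i, (χ x * a₁ i x + dirDeriv (e i) χ x * a x) ^ 2 +
          (∑ i, dirDeriv (e i) χ x ^ 2) * a x ^ 2 := by
      rw [Finset.sum_mul, ← Finset.sum_add_distrib, Finset.mul_sum, Finset.mul_sum]
      refine Finset.sum_le_sum fun i _ => ?_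
      nlinarith [sq_nonneg (χ x * a₁ i x + 2 * (dirDeriv (e i) χ x * a x))]
    have hD : (∑ i, dirDeriv (e i) χ x ^ 2) * a x ^ 2 ≤ δ * κ x * a x ^ 2 :=
      mul_le_mul_of_nonneg_right (h₁ x) (sq_nonneg _)
    have hD0 : 0 ≤ δ * κ x * a x ^ 2 :=
      le_trans (mul_nonneg (Finset.sum_nonneg fun i _ => sq_nonneg _) (sq_nonneg _)) hD
    have hQ0 := hw.deriv_nonneg (ℓ x)
    have hQ1 := hw.deriv_le_one (ℓ x)
    have hE0 := Real.exp_nonneg (2 * φ (ℓ x))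
    simp only
    set D := deriv q (ℓ x)
    set W := Real.exp (2 * φ (ℓ x))
    set S := ∑ i, (χ x * a₁ i x + dirDeriv (e i) χ x * a x) ^ 2
    set S₁ := ∑ i, a₁ i x ^ 2
    calc D * W * χ x ^ 2 * (lam ^ 3 * a x ^ 2 + lam / 2 * S₁)
        = D * W * (lam ^ 3 * (χ x * a x) ^ 2 + lam * (1 / 2 * (χ x ^ 2 * S₁))) := by ring
      _ ≤ D * W * (lam ^ 3 * (χ x * a x) ^ 2 + lam * (S + δ * κ x * a x ^ 2)) := by
          gcongr
          linarith
      _ = D * W * (lam ^ 3 * (χ x * a x) ^ 2 + lam * S) +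
          D * (W * (lam * (δ * κ x * a x ^ 2))) := by ring
      _ ≤ D * W * (lam ^ 3 * (χ x * a x) ^ 2 + lam * S) +
          1 * (W * (lam * (δ * κ x * a x ^ 2))) := by
          gcongr
      _ = _ := by ring
  -- `Δ(χ a)` is a sum of three terms, so its square costs a factor 3 on top of the Carleman
  -- constant 3. The cross term `2 ∇χ · ∇a` brings a further 4, whence 9 and 36.
  have m2 : 3 * (∫ x, Real.exp (2 * φ (ℓ x)) * (∑ i, (χ x * a₂ i x +
      (2 * dirDeriv (e i) χ x * a₁ i x + dirDeriv (e i) (dirDeriv (e i) χ) x * a x))) ^ 2) ≤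
      9 * (∫ x, Real.exp (2 * φ (ℓ x)) * χ x ^ 2 * (∑ i, a₂ i x) ^ 2) +
      δ * ∫ x, Real.exp (2 * φ (ℓ x)) * κ x * (9 * a x ^ 2 + 36 * ∑ i, a₁ i x ^ 2) := by
    rw [← integral_const_mul, ← integral_const_mul, ← integral_const_mul,
      ← integral_add (i2.const_mul 9) (i4.const_mul δ)]
    refine integral_mono (hR.const_mul 3) ((i2.const_mul 9).add (i4.const_mul δ)) fun x => ?_
    have hsplit : ∑ i, (χ x * a₂ i x + (2 * dirDeriv (e i) χ x * a₁ i x +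
        dirDeriv (e i) (dirDeriv (e i) χ) x * a x)) = χ x * (∑ i, a₂ i x) +
        (2 * (∑ i, dirDeriv (e i) χ x * a₁ i x) +
          (∑ i, dirDeriv (e i) (dirDeriv (e i) χ) x) * a x) := by
      simp only [Finset.mul_sum, Finset.sum_mul, ← Finset.sum_add_distrib, mul_assoc]
    have hCS := Finset.sum_mul_sq_le_sq_mul_sq Finset.univ (fun i => dirDeriv (e i) χ x)
      fun i => a₁ i x
    have hS0 : 0 ≤ ∑ i, a₁ i x ^ 2 := Finset.sum_nonneg fun i _ => sq_nonneg _
    have hY2 : (∑ i, dirDeriv (e i) χ x * a₁ i x) ^ 2 ≤ δ * κ x * ∑ i, a₁ i x ^ 2 :=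
      hCS.trans (mul_le_mul_of_nonneg_right (h₁ x) hS0)
    have hT2 : ((∑ i, dirDeriv (e i) (dirDeriv (e i) χ) x) * a x) ^ 2 ≤ δ * κ x * a x ^ 2 := by
      rw [mul_pow]
      exact mul_le_mul_of_nonneg_right (h₂ x) (sq_nonneg _)
    have hE0 := Real.exp_nonneg (2 * φ (ℓ x))
    simp only [hsplit]
    set W := Real.exp (2 * φ (ℓ x))
    set X := χ x * (∑ i, a₂ i x) with hX
    set Y := ∑ i, dirDeriv (e i) χ x * a₁ i x
    set T := (∑ i, dirDeriv (e i) (dirDeriv (e i) χ) x) * a x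
    have hq : (X + (2 * Y + T)) ^ 2 ≤ 3 * (X ^ 2 + 4 * Y ^ 2 + T ^ 2) := by
      nlinarith [sq_nonneg (X - 2 * Y), sq_nonneg (X - T), sq_nonneg (2 * Y - T)]
    calc 3 * (W * (X + (2 * Y + T)) ^ 2)
        ≤ 3 * (W * (3 * (X ^ 2 + 4 * (δ * κ x * ∑ i, a₁ i x ^ 2) + δ * κ x * a x ^ 2))) := by
          gcongr
          linarith
      _ = _ := by
          rw [hX]
          ring
  have m3 : ∫ x, Real.exp (2 * φ (ℓ x)) * κ x * ((lam + 9) * a x ^ 2 + 36 * ∑ i, a₁ i x ^ 2) =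
      (∫ x, Real.exp (2 * φ (ℓ x)) * κ x * (lam * a x ^ 2)) +
      ∫ x, Real.exp (2 * φ (ℓ x)) * κ x * (9 * a x ^ 2 + 36 * ∑ i, a₁ i x ^ 2) := by
    rw [← integral_add i3 i4]
    congr 1
    ext x
    ring
  rw [m3, mul_add]
  linarith

theorem IsH2Limit.energy_sum (h : IsH2Limit e a a₁ a₂) {g : E → ℝ} (hg : ContDiff ℝ ∞ g)
    (hc : HasCompactSupport g) :
    ∫ x, g x * ∑ i, a₁ i x ^ 2 =
      1 / 2 * (∫ x, (∑ i, dirDeriv (e i) (dirDeriv (e i) g) x) * a x ^ 2) -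
      ∫ x, g x * (a x * ∑ i, a₂ i x) := by
  have hg2 : ∀ i, ContDiff ℝ ∞ (dirDeriv (e i) (dirDeriv (e i) g)) := fun i =>
    contDiff_dirDeriv (contDiff_dirDeriv hg)
  have hc2 : ∀ i, HasCompactSupport (dirDeriv (e i) (dirDeriv (e i) g)) := fun i =>
    hasCompactSupport_dirDeriv (hasCompactSupport_dirDeriv hc)
  have i1 : ∀ i, Integrable (fun x => g x * a₁ i x ^ 2) volume := fun i =>
    LocallyIntegrable.integrable_mul_of_hasCompactSupport (h.mem₁ i).locallyIntegrable_sq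
      hg.continuous hc
  have i2 : ∀ i, Integrable (fun x => dirDeriv (e i) (dirDeriv (e i) g) x * a x ^ 2) volume :=
    fun i => LocallyIntegrable.integrable_mul_of_hasCompactSupport h.mem.locallyIntegrable_sq
      (hg2 i).continuous (hc2 i)
  have i3 : ∀ i, Integrable (fun x => g x * (a x * a₂ i x)) volume := fun i =>
    LocallyIntegrable.integrable_mul_of_hasCompactSupport
      (h.mem.locallyIntegrable_mul (h.mem₂ i)) hg.continuous hc
  simp_rw [Finset.mul_sum, Finset.sum_mul]
  rw [integral_finsetSum _ fun i _ => i1 i, integral_finsetSum _ fun i _ => i2 i,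
    integral_finsetSum _ fun i _ => i3 i, Finset.mul_sum, ← Finset.sum_sub_distrib]
  refine Finset.sum_congr rfl fun i _ => ?_
  have := h.energy hg hc i
  simpa only [sq, mul_assoc] using this

end Estimates

/-! ### Caccioppoli's inequality and absorption of the lower order terms. -/

section Vanishing

variable {E : Type*} [NormedAddCommGroup E] [NormedSpace ℝ E] [FiniteDimensional ℝ E]
  [MeasureSpace E] [BorelSpace E] [(volume : Measure E).IsAddHaarMeasure]
  {ι : Type*} [Fintype ι] [DecidableEq ι] {e : ι → E} {i₀ : ι} {ℓ : E →L[ℝ] ℝ}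
  {φ q : ℝ → ℝ} {lam K : ℝ} {a b : E → ℝ} {a₁ a₂ b₁ b₂ : ι → E → ℝ}

/-- Caccioppoli's inequality. -/
theorem integral_gradient_le (ha : IsH2Limit e a a₁ a₂) (hb : IsH2Limit e b b₁ b₂) {C : ℝ}
    (hC : 0 < C)
    (hle : ∀ᵐ x, (∑ i, a₂ i x) ^ 2 + (∑ i, b₂ i x) ^ 2 ≤
      2 * C ^ 2 * (a x ^ 2 + b x ^ 2 + (∑ i, a₁ i x ^ 2 + ∑ i, b₁ i x ^ 2)))
    {g : E → ℝ} (hg : ContDiff ℝ ∞ g) (hc : HasCompactSupport g) (hg0 : ∀ x, 0 ≤ g x) :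
    ∫ x, g x * (∑ i, a₁ i x ^ 2 + ∑ i, b₁ i x ^ 2) ≤
      ∫ x, ((∑ i, dirDeriv (e i) (dirDeriv (e i) g) x) + (1 + 2 * C ^ 2) * g x) *
        (a x ^ 2 + b x ^ 2) := by
  have hg2 : ∀ i, ContDiff ℝ ∞ (dirDeriv (e i) (dirDeriv (e i) g)) := fun i =>
    contDiff_dirDeriv (contDiff_dirDeriv hg)
  have hc2 : HasCompactSupport fun x => ∑ i, dirDeriv (e i) (dirDeriv (e i) g) x := by
    refine HasCompactSupport.of_support_subset_isCompact hc.isCompact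
      (Function.support_subset_iff'.2 fun x hx => Finset.sum_eq_zero fun i _ => ?_)
    exact image_eq_zero_of_notMem_tsupport fun h => hx
      (tsupport_fderiv_apply_subset ℝ _ (tsupport_fderiv_apply_subset ℝ _ h))
  have hcont : Continuous fun x => ∑ i, dirDeriv (e i) (dirDeriv (e i) g) x :=
    continuous_finsetSum _ fun i _ => (hg2 i).continuous
  have la := ha.mem.locallyIntegrable_sq
  have lb := hb.mem.locallyIntegrable_sq
  have la1 := LocallyIntegrable.finset_sum fun i => (ha.mem₁ i).locallyIntegrable_sq
  have lb1 := LocallyIntegrable.finset_sum fun i => (hb.mem₁ i).locallyIntegrable_sq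
  have l0 : LocallyIntegrable (fun x => a x ^ 2 + b x ^ 2) volume := la.add lb
  have l1 : LocallyIntegrable (fun x => ∑ i, a₁ i x ^ 2 + ∑ i, b₁ i x ^ 2) volume := la1.add lb1
  have laa := ha.mem.locallyIntegrable_mul (isL2loc_sum ha.mem₂)
  have lbb := hb.mem.locallyIntegrable_mul (isL2loc_sum hb.mem₂)
  have int : ∀ {f : E → ℝ}, LocallyIntegrable f volume → Integrable (fun x => g x * f x) volume :=
    fun hf => LocallyIntegrable.integrable_mul_of_hasCompactSupport hf hg.continuous hc
  have int2 : ∀ {f : E → ℝ}, LocallyIntegrable f volume → Integrable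
      (fun x => (∑ i, dirDeriv (e i) (dirDeriv (e i) g) x) * f x) volume :=
    fun hf => LocallyIntegrable.integrable_mul_of_hasCompactSupport hf hcont hc2
  have h1 : ∫ x, g x * (∑ i, a₁ i x ^ 2 + ∑ i, b₁ i x ^ 2) =
      1 / 2 * (∫ x, (∑ i, dirDeriv (e i) (dirDeriv (e i) g) x) * (a x ^ 2 + b x ^ 2)) -
      ∫ x, g x * (a x * (∑ i, a₂ i x) + b x * ∑ i, b₂ i x) := by
    simp_rw [mul_add]
    rw [integral_add (int la1) (int lb1), integral_add (int2 la) (int2 lb),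
      integral_add (int laa) (int lbb), ha.energy_sum hg hc, hb.energy_sum hg hc]
    ring
  have h2 : -∫ x, g x * (a x * (∑ i, a₂ i x) + b x * ∑ i, b₂ i x) ≤
      (1 / 2 + C ^ 2) * (∫ x, g x * (a x ^ 2 + b x ^ 2)) +
      1 / 2 * ∫ x, g x * (∑ i, a₁ i x ^ 2 + ∑ i, b₁ i x ^ 2) := by
    rw [← integral_neg, ← integral_const_mul, ← integral_const_mul,
      ← integral_add ((int l0).const_mul _) ((int l1).const_mul _)]
    refine integral_mono_ae (int (laa.add lbb)).neg
      (((int l0).const_mul _).add ((int l1).const_mul _)) ?_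
    filter_upwards [hle] with x hx
    set A := ∑ i, a₂ i x
    set B := ∑ i, b₂ i x
    set S := ∑ i, a₁ i x ^ 2 + ∑ i, b₁ i x ^ 2
    -- Young's inequality with parameter `2 C²`: dividing `A² + B²` by `4 C²` turns the hypothesis
    -- into half of `a² + b² + S`, so only half of the gradient term appears and it can be moved to
    -- the left side.
    have h3 : -(a x * A + b x * B) ≤ (1 / 2 + C ^ 2) * (a x ^ 2 + b x ^ 2) + 1 / 2 * S := by
      have hC2 : 0 < C ^ 2 := by positivity
      have h4 : 4 * C ^ 2 * -(a x * A + b x * B) ≤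
          4 * C ^ 2 * ((1 / 2 + C ^ 2) * (a x ^ 2 + b x ^ 2) + 1 / 2 * S) := by
        nlinarith [sq_nonneg (A + 2 * C ^ 2 * a x), sq_nonneg (B + 2 * C ^ 2 * b x)]
      exact le_of_mul_le_mul_left h4 (by positivity)
    have := mul_le_mul_of_nonneg_left h3 (hg0 x)
    linarith
  have h3 : ∫ x, ((∑ i, dirDeriv (e i) (dirDeriv (e i) g) x) + (1 + 2 * C ^ 2) * g x) *
        (a x ^ 2 + b x ^ 2) =
      (∫ x, (∑ i, dirDeriv (e i) (dirDeriv (e i) g) x) * (a x ^ 2 + b x ^ 2)) +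
      (1 + 2 * C ^ 2) * ∫ x, g x * (a x ^ 2 + b x ^ 2) := by
    rw [← integral_const_mul, ← integral_add (int2 l0) ((int l0).const_mul _)]
    congr 1
    ext x
    ring
  linarith

/-- The Carleman inequality for solutions of the differential inequality: the lower order terms are
absorbed. -/
theorem carleman_solution (ha : IsH2Limit e a a₁ a₂) (hb : IsH2Limit e b b₁ b₂)
    (hℓ : ∀ i, ℓ (e i) = if i = i₀ then 1 else 0)
    (hw : IsCarlemanWeight φ q lam K) {C : ℝ} (hlam : 36 * C ^ 2 + 1 ≤ lam)
    (hle : ∀ᵐ x, (∑ i, a₂ i x) ^ 2 + (∑ i, b₂ i x) ^ 2 ≤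
      2 * C ^ 2 * deriv q (ℓ x) * (a x ^ 2 + b x ^ 2 + (∑ i, a₁ i x ^ 2 + ∑ i, b₁ i x ^ 2)))
    {χ κ : E → ℝ} (hχ : ContDiff ℝ ∞ χ)
    (hc : HasCompactSupport χ) (hκ : Continuous κ) (hκc : HasCompactSupport κ) {δ : ℝ}
    (h₁ : ∀ x, ∑ i, dirDeriv (e i) χ x ^ 2 ≤ δ * κ x)
    (h₂ : ∀ x, (∑ i, dirDeriv (e i) (dirDeriv (e i) χ) x) ^ 2 ≤ δ * κ x) :
    ∫ x, deriv q (ℓ x) * Real.exp (2 * φ (ℓ x)) * χ x ^ 2 * (a x ^ 2 + b x ^ 2) ≤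
      δ * ((lam + 9) * (∫ x, Real.exp (2 * φ (ℓ x)) * κ x * (a x ^ 2 + b x ^ 2)) +
        36 * ∫ x, Real.exp (2 * φ (ℓ x)) * κ x * (∑ i, a₁ i x ^ 2 + ∑ i, b₁ i x ^ 2)) := by
  have hlam1 : 1 ≤ lam := by nlinarith [sq_nonneg C]
  have hlam3 : lam ≤ lam ^ 3 := le_self_pow₀ hlam1 (by norm_num)
  have hq1 : ContDiff ℝ ∞ (deriv q) := (contDiff_infty_iff_deriv.1 hw.contDiff_slope).2
  have hE : Continuous fun x => Real.exp (2 * φ (ℓ x)) := by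
    have := hw.contDiff.continuous
    fun_prop
  have hm : Continuous fun x => deriv q (ℓ x) * Real.exp (2 * φ (ℓ x)) := by
    have := hq1.continuous
    fun_prop
  have hχs : HasCompactSupport fun x => χ x ^ 2 := by
    simp_rw [sq]; exact hc.mul_left
  have la := ha.mem.locallyIntegrable_sq
  have lb := hb.mem.locallyIntegrable_sq
  have la1 := LocallyIntegrable.finset_sum fun i => (ha.mem₁ i).locallyIntegrable_sq
  have lb1 := LocallyIntegrable.finset_sum fun i => (hb.mem₁ i).locallyIntegrable_sq
  have l0 : LocallyIntegrable (fun x => a x ^ 2 + b x ^ 2) volume := la.add lb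
  have l1 : LocallyIntegrable (fun x => ∑ i, a₁ i x ^ 2 + ∑ i, b₁ i x ^ 2) volume := la1.add lb1
  have lcomb : ∀ (c d : ℝ) {f g : E → ℝ}, LocallyIntegrable f volume →
      LocallyIntegrable g volume → LocallyIntegrable (fun x => c * f x + d * g x) volume :=
    fun c d _ _ hf hg => (hf.smul c).add (hg.smul d)
  have la2 := (isL2loc_sum ha.mem₂).locallyIntegrable_sq
  have lb2 := (isL2loc_sum hb.mem₂).locallyIntegrable_sq
  have im : ∀ {f : E → ℝ}, LocallyIntegrable f volume → Integrable
      (fun x => deriv q (ℓ x) * Real.exp (2 * φ (ℓ x)) * χ x ^ 2 * f x) volume := fun hf =>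
    LocallyIntegrable.integrable_mul_of_hasCompactSupport hf (hm.mul (hχ.continuous.pow 2))
      hχs.mul_left
  have iE : ∀ {f : E → ℝ}, LocallyIntegrable f volume → Integrable
      (fun x => Real.exp (2 * φ (ℓ x)) * χ x ^ 2 * f x) volume := fun hf =>
    LocallyIntegrable.integrable_mul_of_hasCompactSupport hf (hE.mul (hχ.continuous.pow 2))
      hχs.mul_left
  have iκ : ∀ {f : E → ℝ}, LocallyIntegrable f volume → Integrable
      (fun x => Real.exp (2 * φ (ℓ x)) * κ x * f x) volume := fun hf =>
    LocallyIntegrable.integrable_mul_of_hasCompactSupport hf (hE.mul hκ) hκc.mul_left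
  have ka := ha.carleman_cutoff hℓ hw hχ hc hκ hκc h₁ h₂
  have kb := hb.carleman_cutoff hℓ hw hχ hc hκ hκc h₁ h₂
  have hrhs : (∫ x, Real.exp (2 * φ (ℓ x)) * κ x *
        ((lam + 9) * a x ^ 2 + 36 * ∑ i, a₁ i x ^ 2)) +
      (∫ x, Real.exp (2 * φ (ℓ x)) * κ x * ((lam + 9) * b x ^ 2 + 36 * ∑ i, b₁ i x ^ 2)) =
      (lam + 9) * (∫ x, Real.exp (2 * φ (ℓ x)) * κ x * (a x ^ 2 + b x ^ 2)) +
        36 * ∫ x, Real.exp (2 * φ (ℓ x)) * κ x * (∑ i, a₁ i x ^ 2 + ∑ i, b₁ i x ^ 2) := by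
    rw [← integral_add (iκ (lcomb (lam + 9) 36 la la1))
      (iκ (lcomb (lam + 9) 36 lb lb1)), ← integral_const_mul,
      ← integral_const_mul, ← integral_add ((iκ l0).const_mul _)
        ((iκ l1).const_mul _)]
    congr 1
    ext x
    ring
  have hmain : (∫ x, deriv q (ℓ x) * Real.exp (2 * φ (ℓ x)) * χ x ^ 2 * (a x ^ 2 + b x ^ 2)) +
      9 * ((∫ x, Real.exp (2 * φ (ℓ x)) * χ x ^ 2 * (∑ i, a₂ i x) ^ 2) +
        ∫ x, Real.exp (2 * φ (ℓ x)) * χ x ^ 2 * (∑ i, b₂ i x) ^ 2) ≤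
      (∫ x, deriv q (ℓ x) * Real.exp (2 * φ (ℓ x)) * χ x ^ 2 *
        (lam ^ 3 * a x ^ 2 + lam / 2 * ∑ i, a₁ i x ^ 2)) +
      ∫ x, deriv q (ℓ x) * Real.exp (2 * φ (ℓ x)) * χ x ^ 2 *
        (lam ^ 3 * b x ^ 2 + lam / 2 * ∑ i, b₁ i x ^ 2) := by
    have j1 := im l0
    have j2 := ((iE la2).add (iE lb2)).const_mul 9
    have j3 := im (lcomb (lam ^ 3) (lam / 2) la la1)
    have j4 := im (lcomb (lam ^ 3) (lam / 2) lb lb1)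
    rw [← integral_add (iE la2) (iE lb2), ← integral_const_mul]
    refine (integral_add j1 j2).symm.trans_le (le_trans ?_ (integral_add j3 j4).le)
    refine integral_mono_ae (j1.add j2) (j3.add j4) ?_
    filter_upwards [hle] with x hx
    simp only [Pi.add_apply]
    have hQ0 := hw.deriv_nonneg (ℓ x)
    have hE0 := Real.exp_nonneg (2 * φ (ℓ x))
    have hSa : 0 ≤ ∑ i, a₁ i x ^ 2 := Finset.sum_nonneg fun i _ => sq_nonneg _
    have hSb : 0 ≤ ∑ i, b₁ i x ^ 2 := Finset.sum_nonneg fun i _ => sq_nonneg _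
    set D := deriv q (ℓ x)
    set W := Real.exp (2 * φ (ℓ x))
    set A := ∑ i, a₂ i x
    set B := ∑ i, b₂ i x
    set Sa := ∑ i, a₁ i x ^ 2
    set Sb := ∑ i, b₁ i x ^ 2
    have hN : 0 ≤ a x ^ 2 + b x ^ 2 := by positivity
    -- The term `9 (A² + B²)` is at most `18 C² q'` times the zeroth and first order squares. The
    -- condition `lam ≥ 36 C² + 1` fits the gradient part under `lam / 2`, and leaves one copy of
    -- `q' (a² + b²)` to spare in the zeroth order part because `lam³ ≥ lam`.
    have hpt : D * (a x ^ 2 + b x ^ 2) + 9 * (A ^ 2 + B ^ 2) ≤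
        D * (lam ^ 3 * (a x ^ 2 + b x ^ 2) + lam / 2 * (Sa + Sb)) := by
      have h5 : D * (18 * C ^ 2 + 1) * (a x ^ 2 + b x ^ 2) ≤ D * lam ^ 3 * (a x ^ 2 + b x ^ 2) := by
        gcongr
        nlinarith [sq_nonneg C]
      have h6 : D * (18 * C ^ 2) * (Sa + Sb) ≤ D * (lam / 2) * (Sa + Sb) := by
        gcongr
        linarith
      nlinarith
    have := mul_le_mul_of_nonneg_left hpt (mul_nonneg hE0 (sq_nonneg (χ x)))
    linarith
  rw [← hrhs, mul_add]
  linarith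

end Vanishing

/-! ### Cutoffs at scale `R` and the vanishing argument. -/

section Vanishing

variable {E : Type*} [NormedAddCommGroup E] [NormedSpace ℝ E] [FiniteDimensional ℝ E]
  [MeasureSpace E] [BorelSpace E] [(volume : Measure E).IsAddHaarMeasure]
  {ι : Type*} [Fintype ι] [DecidableEq ι] {e : ι → E} {i₀ : ι} {ℓ : E →L[ℝ] ℝ}
  {φ q : ℝ → ℝ} {lam K : ℝ} {a b : E → ℝ} {a₁ a₂ b₁ b₂ : ι → E → ℝ}

theorem dirDeriv_comp_smul {θ : E → ℝ} (hθ : ContDiff ℝ ∞ θ) (v : E) (c : ℝ) :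
    dirDeriv v (fun x => θ (c • x)) = fun x => c * dirDeriv v θ (c • x) := by
  ext x
  have h1 : HasFDerivAt θ (fderiv ℝ θ (c • x)) (c • x) :=
    (hθ.differentiable (by simp) _).hasFDerivAt
  have h2 : HasFDerivAt (fun x : E => c • x) (c • ContinuousLinearMap.id ℝ E) x :=
    (hasFDerivAt_id x).const_smul c
  simp only [dirDeriv]
  rw [show (fun x => θ (c • x)) = θ ∘ fun x => c • x from rfl, (h1.comp x h2).fderiv]
  simp

/-- Smooth cutoffs at scale `R`, with derivatives of size `1 / R`. -/
theorem exists_cutoff (e : ι → E) : ∃ (χ : ℝ → E → ℝ) (B : ℝ), 0 ≤ B ∧ ∀ R, 1 ≤ R →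
    ContDiff ℝ ∞ (χ R) ∧ tsupport (χ R) ⊆ Metric.closedBall 0 (2 * R) ∧
    (∀ x, 0 ≤ χ R x) ∧ (∀ x, χ R x ≤ 1) ∧ (∀ x ∈ Metric.closedBall 0 R, χ R x = 1) ∧
    (∀ x, ∑ i, dirDeriv (e i) (χ R) x ^ 2 ≤ B / R ^ 2) ∧
    ∀ x, (∑ i, dirDeriv (e i) (dirDeriv (e i) (χ R)) x) ^ 2 ≤ B / R ^ 2 := by
  let θ : ContDiffBump (0 : E) := ⟨1, 2, one_pos, one_lt_two⟩
  have hθ : ContDiff ℝ ∞ (θ : E → ℝ) := θ.contDiff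
  have hθ1 : ∀ i, ContDiff ℝ ∞ (dirDeriv (e i) θ) := fun i => contDiff_dirDeriv hθ
  have hθ2 : ∀ i, ContDiff ℝ ∞ (dirDeriv (e i) (dirDeriv (e i) θ)) := fun i =>
    contDiff_dirDeriv (hθ1 i)
  have hcs : ∀ {g : E → ℝ} {i : ι}, tsupport g ⊆ tsupport θ →
      tsupport (dirDeriv (e i) g) ⊆ tsupport θ := fun h =>
    (tsupport_fderiv_apply_subset ℝ _).trans h
  have hbdd : ∀ {g : E → ℝ}, Continuous g → (∀ x ∉ tsupport θ, g x = 0) → ∃ B, ∀ x, ‖g x‖ ≤ B :=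
    fun {g} hg h0 => hg.bounded_above_of_compact_support
      (HasCompactSupport.of_support_subset_isCompact θ.hasCompactSupport
        (Function.support_subset_iff'.2 h0))
  obtain ⟨B₁, hB₁⟩ := hbdd (g := fun x => ∑ i, dirDeriv (e i) θ x ^ 2)
    (continuous_finsetSum _ fun i _ => (hθ1 i).continuous.pow 2) fun x hx =>
      Finset.sum_eq_zero fun i _ => by
        rw [image_eq_zero_of_notMem_tsupport fun h => hx (hcs subset_rfl h)]; simp
  obtain ⟨B₂, hB₂⟩ := hbdd (g := fun x => (∑ i, dirDeriv (e i) (dirDeriv (e i) θ) x) ^ 2)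
    ((continuous_finsetSum _ fun i _ => (hθ2 i).continuous).pow 2) fun x hx => by
      rw [Finset.sum_eq_zero fun i _ => image_eq_zero_of_notMem_tsupport
        fun h => hx (hcs (hcs subset_rfl) h)]
      simp
  have hB₁0 : 0 ≤ B₁ := (norm_nonneg _).trans (hB₁ 0)
  refine ⟨fun R x => θ (R⁻¹ • x), max B₁ B₂, le_max_of_le_left hB₁0, fun R hR => ?_⟩
  have hR0 : 0 < R := by linarith
  have hd1 : ∀ i, dirDeriv (e i) (fun x => θ (R⁻¹ • x)) = fun x =>
      R⁻¹ * dirDeriv (e i) θ (R⁻¹ • x) := fun i => dirDeriv_comp_smul hθ _ _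
  have hsm : ∀ {g : E → ℝ}, ContDiff ℝ ∞ g → ContDiff ℝ ∞ fun x => g (R⁻¹ • x) := fun hg =>
    hg.comp (contDiff_const_smul _)
  have hd2 : ∀ i x, dirDeriv (e i) (dirDeriv (e i) (fun x => θ (R⁻¹ • x))) x =
      R⁻¹ ^ 2 * dirDeriv (e i) (dirDeriv (e i) θ) (R⁻¹ • x) := by
    intro i x
    rw [hd1, dirDeriv_const_mul _ (hsm (hθ1 i)), dirDeriv_comp_smul (hθ1 i)]
    ring
  refine ⟨hsm hθ, ?_, fun x => θ.nonneg, fun x => θ.le_one, fun x hx => ?_, fun x => ?_,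
    fun x => ?_⟩
  · refine closure_minimal (fun x hx => ?_) Metric.isClosed_closedBall
    have : R⁻¹ • x ∈ Function.support θ := hx
    rw [θ.support_eq] at this
    simp only [mem_ball_zero_iff, norm_smul, norm_inv, Real.norm_eq_abs, abs_of_pos hR0] at this
    rw [mem_closedBall_zero_iff]
    rw [inv_mul_lt_iff₀ hR0] at this
    change ‖x‖ < R * 2 at this
    linarith
  · refine θ.one_of_mem_closedBall ?_
    rw [mem_closedBall_zero_iff] at hx ⊢
    simp only [norm_smul, norm_inv, Real.norm_eq_abs, abs_of_pos hR0]
    rw [inv_mul_le_iff₀ hR0]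
    change ‖x‖ ≤ R * 1
    linarith
  · simp only [hd1, mul_pow, ← Finset.mul_sum]
    have := (le_abs_self _).trans ((hB₁ (R⁻¹ • x)).trans (le_max_left B₁ B₂))
    rw [div_eq_inv_mul, inv_pow]
    gcongr
  · simp only [hd2, ← Finset.mul_sum, mul_pow]
    have := (le_abs_self _).trans ((hB₂ (R⁻¹ • x)).trans (le_max_right B₁ B₂))
    rw [div_eq_inv_mul, ← inv_pow]
    -- The true size is `R⁻⁴`; for `R ≥ 1` it is weakened to `R⁻²` so that one `δ` serves both
    -- derivative bounds.
    calc (R⁻¹ ^ 2) ^ 2 * (∑ i, dirDeriv (e i) (dirDeriv (e i) θ) (R⁻¹ • x)) ^ 2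
        ≤ R⁻¹ ^ 2 * (∑ i, dirDeriv (e i) (dirDeriv (e i) θ) (R⁻¹ • x)) ^ 2 := by
          gcongr
          exact pow_le_of_le_one (by positivity) (inv_le_one_of_one_le₀ hR) two_ne_zero
      _ ≤ R⁻¹ ^ 2 * max B₁ B₂ := by gcongr

/-- Integrals against coefficients dominated by `c * f₀` on a compact set `S` and vanishing outside. -/
theorem integral_mul_le_of_le_indicator {f₀ N g : E → ℝ} {S : Set E} {c : ℝ} (hS : IsCompact S)
    (hg : Continuous g) (hgS : ∀ x ∉ S, g x = 0) (hle : ∀ x ∈ S, g x ≤ c * f₀ x)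
    (hf₀ : Continuous f₀) (hN : LocallyIntegrable N volume) (hN0 : ∀ x, 0 ≤ N x) :
    ∫ x, g x * N x ≤ c * ∫ x in S, f₀ x * N x := by
  have hNS := locallyIntegrable_iff.1 hN S hS
  rw [← setIntegral_eq_integral_of_forall_compl_eq_zero (s := S) fun x hx => by simp [hgS x hx],
    ← integral_const_mul]
  refine setIntegral_mono_on (hNS.continuousOn_mul hg.continuousOn hS)
    ((hNS.continuousOn_mul hf₀.continuousOn hS).const_mul c) hS.measurableSet fun x hx => ?_
  rw [← mul_assoc]
  exact mul_le_mul_of_nonneg_right (hle x hx) (hN0 x)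

/-- Linear growth of the weighted mass on balls is beaten by the factor `1 / R²` of the cutoffs. The
weighted gradient inherits linear growth from Caccioppoli's inequality, where the bound `q ≤ Q`
keeps `Δ(exp(2φ) χ)` below a multiple of `exp(2φ)`. Positivity of `q'` is used only at the end, to
read off `a = b = 0` from a vanishing integral. -/
theorem ae_eq_zero_of_carleman (ha : IsH2Limit e a a₁ a₂) (hb : IsH2Limit e b b₁ b₂)
    (hℓ : ∀ i, ℓ (e i) = if i = i₀ then 1 else 0)
    (hw : IsCarlemanWeight φ q lam K) {C : ℝ} (hC : 0 < C) (hlam : 36 * C ^ 2 + 1 ≤ lam)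
    (hle : ∀ᵐ x, (∑ i, a₂ i x) ^ 2 + (∑ i, b₂ i x) ^ 2 ≤
      2 * C ^ 2 * deriv q (ℓ x) * (a x ^ 2 + b x ^ 2 + (∑ i, a₁ i x ^ 2 + ∑ i, b₁ i x ^ 2)))
    (hpos : ∀ r, 0 < deriv q r) {Q : ℝ} (hQ : ∀ r, q r ≤ Q) {M : ℝ}
    (hM : ∀ R, 1 ≤ R → ∫ x in Metric.closedBall (0 : E) R,
      Real.exp (2 * φ (ℓ x)) * (a x ^ 2 + b x ^ 2) ≤ M * R) :
    ∀ᵐ x, a x = 0 ∧ b x = 0 := by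
  obtain ⟨χ, B, hB, hχ⟩ := exists_cutoff e
  have hq1 : ContDiff ℝ ∞ (deriv q) := (contDiff_infty_iff_deriv.1 hw.contDiff_slope).2
  have hlam1 : 1 ≤ lam := by nlinarith [sq_nonneg C]
  have hQ1 : 1 ≤ Q := (hw.one_le 0).trans (hQ 0)
  have hE : Continuous fun x => Real.exp (2 * φ (ℓ x)) := by
    have := hw.contDiff.continuous
    fun_prop
  have hm : Continuous fun x => deriv q (ℓ x) * Real.exp (2 * φ (ℓ x)) := by
    have := hq1.continuous
    fun_prop
  have l0 : LocallyIntegrable (fun x => a x ^ 2 + b x ^ 2) volume :=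
    ha.mem.locallyIntegrable_sq.add hb.mem.locallyIntegrable_sq
  have hN0 : ∀ x, 0 ≤ a x ^ 2 + b x ^ 2 := fun x => by positivity
  have hS0 : ∀ x, 0 ≤ ∑ i, a₁ i x ^ 2 + ∑ i, b₁ i x ^ 2 := fun x =>
    add_nonneg (Finset.sum_nonneg fun i _ => sq_nonneg _) (Finset.sum_nonneg fun i _ => sq_nonneg _)
  have hle1 : ∀ᵐ x, (∑ i, a₂ i x) ^ 2 + (∑ i, b₂ i x) ^ 2 ≤
      2 * C ^ 2 * (a x ^ 2 + b x ^ 2 + (∑ i, a₁ i x ^ 2 + ∑ i, b₁ i x ^ 2)) := by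
    filter_upwards [hle] with x hx
    refine hx.trans (mul_le_mul_of_nonneg_right ?_ (add_nonneg (hN0 x) (hS0 x)))
    exact mul_le_of_le_one_right (by positivity) (hw.deriv_le_one _)
  -- the weight `exp (2 φ)` and its logarithmic derivative
  let w : ℝ → ℝ := fun r => Real.exp (2 * φ r)
  let p : ℝ → ℝ := fun r => 2 * lam * q r
  have hwc : ContDiff ℝ ∞ w := (contDiff_const.mul hw.contDiff).exp
  have hpc : ContDiff ℝ ∞ p := contDiff_const.mul hw.contDiff_slope
  have hwp : ∀ r, deriv w r = w r * p r := by
    intro r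
    have h1 : HasDerivAt φ (lam * q r) r := by
      rw [← hw.deriv_eq]
      exact (hw.contDiff.differentiable (by simp) r).hasDerivAt
    have h2 := ((h1.const_mul 2).exp).deriv
    simp only [w, p]
    rw [h2]
    ring
  have hp' : ∀ r, deriv p r = 2 * lam * deriv q r := fun r =>
    deriv_const_mul _ (hw.contDiff_slope.differentiable (by simp) r)
  -- The summands bound, in order, `Δχ`, twice the product of the logarithmic derivative of
  -- `exp(2φ)` with `∂χ`, the second derivative of the weight times `χ`, and the zeroth order
  -- coefficient in Caccioppoli's inequality. The bound `1 + B` for `X` comes from `X² ≤ B`.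
  set B₂ : ℝ := (1 + B) + 4 * lam * Q * (1 + B) + (4 * lam ^ 2 * Q ^ 2 + 2 * lam) + (1 + 2 * C ^ 2)
  have hB₂ : 0 ≤ B₂ := by positivity
  -- the energy on balls grows at most linearly
  have henergy : ∀ R, 1 ≤ R → ∫ x, Real.exp (2 * φ (ℓ x)) * χ R x *
      (∑ i, a₁ i x ^ 2 + ∑ i, b₁ i x ^ 2) ≤ B₂ * (M * (2 * R)) := by
    intro R hR
    obtain ⟨hχ1, hχ2, hχ3, hχ4, hχ5, hχ6, hχ7⟩ := hχ R hR
    have hcs : HasCompactSupport (χ R) :=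
      HasCompactSupport.of_support_subset_isCompact (isCompact_closedBall 0 (2 * R))
        ((subset_tsupport _).trans hχ2)
    have hg : ContDiff ℝ ∞ fun x => w (ℓ x) * χ R x := (hwc.comp ℓ.contDiff).mul hχ1
    have hBR : B / R ^ 2 ≤ B := div_le_self hB (one_le_pow₀ hR)
    refine (integral_gradient_le ha hb hC hle1 hg hcs.mul_left
      fun x => mul_nonneg (Real.exp_nonneg _) (hχ3 x)).trans ?_
    refine le_trans ?_ (mul_le_mul_of_nonneg_left (hM (2 * R) (by linarith)) hB₂)
    have hlap : ∀ x, ∑ i, dirDeriv (e i) (dirDeriv (e i) (fun x => w (ℓ x) * χ R x)) x =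
        w (ℓ x) * ((∑ i, dirDeriv (e i) (dirDeriv (e i) (χ R)) x) +
          (2 * p (ℓ x) * dirDeriv (e i₀) (χ R) x + (p (ℓ x) ^ 2 + deriv p (ℓ x)) * χ R x)) := by
      intro x
      simp_rw [fun i => dirDeriv_dirDeriv_weight_mul hℓ hwc hpc hwp hχ1 i x]
      rw [← Finset.mul_sum, Finset.sum_add_distrib]
      simp only [ite_mul, one_mul, zero_mul, Finset.sum_ite_eq', Finset.mem_univ, if_true]
    simp_rw [hlap]
    have hd1 : ∀ i, ContDiff ℝ ∞ (dirDeriv (e i) (χ R)) := fun i => contDiff_dirDeriv hχ1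
    have hd2 : ∀ i, ContDiff ℝ ∞ (dirDeriv (e i) (dirDeriv (e i) (χ R))) := fun i =>
      contDiff_dirDeriv (hd1 i)
    refine integral_mul_le_of_le_indicator (isCompact_closedBall 0 (2 * R)) ?_ (fun x hx => ?_)
      (fun x _ => ?_) hE l0 hN0
    · have c1 := hwc.continuous
      have c2 := hpc.continuous
      have c3 := fun i => (hd2 i).continuous
      have c4 := (hd1 i₀).continuous
      have c5 : Continuous (deriv p) := ((contDiff_infty_iff_deriv.1 hpc).2).continuous
      have c6 := hχ1.continuous
      fun_prop
    · have hx' : x ∉ tsupport (χ R) := fun h => hx (hχ2 h)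
      have k1 : ∀ i, x ∉ tsupport (dirDeriv (e i) (χ R)) := fun i h =>
        hx' (tsupport_fderiv_apply_subset ℝ _ h)
      have k2 : ∀ i, x ∉ tsupport (dirDeriv (e i) (dirDeriv (e i) (χ R))) := fun i h =>
        k1 i (tsupport_fderiv_apply_subset ℝ _ h)
      simp [image_eq_zero_of_notMem_tsupport hx', image_eq_zero_of_notMem_tsupport (k1 i₀),
        fun i => image_eq_zero_of_notMem_tsupport (k2 i)]
    · have e1 : ∑ i, dirDeriv (e i) (dirDeriv (e i) (χ R)) x ≤ 1 + B := by
        nlinarith [hχ7 x, sq_nonneg (∑ i, dirDeriv (e i) (dirDeriv (e i) (χ R)) x - 1)]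
      have e2 : dirDeriv (e i₀) (χ R) x ≤ 1 + B := by
        have := (Finset.single_le_sum (f := fun i => dirDeriv (e i) (χ R) x ^ 2)
          (fun i _ => sq_nonneg _) (Finset.mem_univ i₀)).trans (hχ6 x)
        nlinarith [sq_nonneg (dirDeriv (e i₀) (χ R) x - 1)]
      have hq0 : 0 ≤ q (ℓ x) := by linarith [hw.one_le (ℓ x)]
      have e3 : p (ℓ x) * dirDeriv (e i₀) (χ R) x ≤ 2 * lam * Q * (1 + B) := by
        simp only [p]
        calc 2 * lam * q (ℓ x) * dirDeriv (e i₀) (χ R) x ≤ 2 * lam * q (ℓ x) * (1 + B) := by gcongr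
          _ ≤ 2 * lam * Q * (1 + B) := by
            have := hQ (ℓ x)
            gcongr
      have e4 : (p (ℓ x) ^ 2 + deriv p (ℓ x)) * χ R x ≤ 4 * lam ^ 2 * Q ^ 2 + 2 * lam := by
        have f1 : p (ℓ x) ^ 2 ≤ 4 * lam ^ 2 * Q ^ 2 := by
          have : q (ℓ x) ^ 2 ≤ Q ^ 2 := pow_le_pow_left₀ hq0 (hQ _) 2
          simp only [p]
          nlinarith [sq_nonneg lam]
        have f2 : deriv p (ℓ x) ≤ 2 * lam := by
          rw [hp']
          nlinarith [hw.deriv_le_one (ℓ x)]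
        have f3 : 0 ≤ deriv p (ℓ x) := by
          rw [hp']
          exact mul_nonneg (by positivity) (hw.deriv_nonneg _)
        calc (p (ℓ x) ^ 2 + deriv p (ℓ x)) * χ R x ≤ (p (ℓ x) ^ 2 + deriv p (ℓ x)) * 1 := by
              have := hχ4 x
              gcongr
          _ ≤ _ := by linarith
      have e5 : (1 + 2 * C ^ 2) * χ R x ≤ 1 + 2 * C ^ 2 :=
        mul_le_of_le_one_right (by positivity) (hχ4 x)
      have hw0 : 0 ≤ w (ℓ x) := Real.exp_nonneg _
      have e6 := mul_le_mul_of_nonneg_left (add_le_add (add_le_add e1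
        (add_le_add (add_le_add e3 e3) e4)) e5) hw0
      change _ ≤ B₂ * w (ℓ x)
      simp only [B₂]
      linarith
  -- the Carleman inequality at scale `R`
  have hcarl : ∀ R, 1 ≤ R → ∫ x in Metric.closedBall (0 : E) R,
      deriv q (ℓ x) * Real.exp (2 * φ (ℓ x)) * (a x ^ 2 + b x ^ 2) ≤
      4 * B * M * ((lam + 9) + 36 * B₂) / R := by
    intro R hR
    have hR0 : 0 < R := by linarith
    obtain ⟨hχ1, hχ2, hχ3, hχ4, hχ5, hχ6, hχ7⟩ := hχ R hR
    obtain ⟨hκ1, hκ2, hκ3, hκ4, hκ5, hκ6, hκ7⟩ := hχ (2 * R) (by linarith)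
    have hcs : HasCompactSupport (χ R) :=
      HasCompactSupport.of_support_subset_isCompact (isCompact_closedBall 0 (2 * R))
        ((subset_tsupport _).trans hχ2)
    have hκs : HasCompactSupport (χ (2 * R)) :=
      HasCompactSupport.of_support_subset_isCompact (isCompact_closedBall 0 (2 * (2 * R)))
        ((subset_tsupport _).trans hκ2)
    -- The second cutoff is `χ (2R)`: it equals 1 on the ball of radius `2R`, outside which the
    -- derivatives of `χ R` vanish. Its own support lies in the ball of radius `4R`, hence the
    -- factor 4 in the bound.
    have hcut : ∀ x, (x ∈ Metric.closedBall 0 (2 * R) → χ (2 * R) x = 1) ∧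
        (x ∉ Metric.closedBall 0 (2 * R) → (∀ i, dirDeriv (e i) (χ R) x = 0) ∧
          ∀ i, dirDeriv (e i) (dirDeriv (e i) (χ R)) x = 0) := by
      refine fun x => ⟨hκ5 x, fun hx => ?_⟩
      have k1 : ∀ i, x ∉ tsupport (dirDeriv (e i) (χ R)) := fun i h =>
        hx (hχ2 (tsupport_fderiv_apply_subset ℝ _ h))
      have k2 : ∀ i, x ∉ tsupport (dirDeriv (e i) (dirDeriv (e i) (χ R))) := fun i h =>
        k1 i (tsupport_fderiv_apply_subset ℝ _ h)
      exact ⟨fun i => image_eq_zero_of_notMem_tsupport (k1 i),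
        fun i => image_eq_zero_of_notMem_tsupport (k2 i)⟩
    have hδ : 0 ≤ B / R ^ 2 := by positivity
    have key := carleman_solution ha hb hℓ hw hlam hle hχ1 hcs hκ1.continuous hκs
      (δ := B / R ^ 2) (fun x => by
        by_cases hx : x ∈ Metric.closedBall 0 (2 * R)
        · rw [(hcut x).1 hx, mul_one]; exact hχ6 x
        · simp only [((hcut x).2 hx).1]
          simpa using mul_nonneg hδ (hκ3 x)) (fun x => by
        by_cases hx : x ∈ Metric.closedBall 0 (2 * R)
        · rw [(hcut x).1 hx, mul_one]; exact hχ7 x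
        · simp only [((hcut x).2 hx).2]
          simpa using mul_nonneg hδ (hκ3 x))
    have hzero : ∫ x, Real.exp (2 * φ (ℓ x)) * χ (2 * R) x * (a x ^ 2 + b x ^ 2) ≤
        M * (2 * (2 * R)) := by
      have hEκ : Continuous fun x => Real.exp (2 * φ (ℓ x)) * χ (2 * R) x := hE.mul hκ1.continuous
      refine (integral_mul_le_of_le_indicator (c := 1) (isCompact_closedBall 0 (2 * (2 * R)))
        hEκ (fun x hx => ?_) (fun x _ => ?_) hE l0 hN0).trans ?_
      · rw [image_eq_zero_of_notMem_tsupport fun h => hx (hκ2 h), mul_zero]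
      · rw [one_mul]
        exact mul_le_of_le_one_right (Real.exp_nonneg _) (hκ4 x)
      · rw [one_mul]
        exact hM _ (by linarith)
    have hone := henergy (2 * R) (by linarith)
    have hLHS : ∫ x in Metric.closedBall (0 : E) R,
        deriv q (ℓ x) * Real.exp (2 * φ (ℓ x)) * (a x ^ 2 + b x ^ 2) ≤
        ∫ x, deriv q (ℓ x) * Real.exp (2 * φ (ℓ x)) * χ R x ^ 2 * (a x ^ 2 + b x ^ 2) := by
      have hint : Integrable (fun x => deriv q (ℓ x) * Real.exp (2 * φ (ℓ x)) * χ R x ^ 2 *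
          (a x ^ 2 + b x ^ 2)) volume := by
        refine LocallyIntegrable.integrable_mul_of_hasCompactSupport l0
          (hm.mul (hχ1.continuous.pow 2)) (HasCompactSupport.mul_left ?_)
        simp_rw [sq]
        exact hcs.mul_left
      refine le_trans (le_of_eq ?_) (setIntegral_le_integral (s := Metric.closedBall (0 : E) R) hint
        (Eventually.of_forall fun x => ?_))
      · refine setIntegral_congr_fun Metric.isClosed_closedBall.measurableSet fun x hx => ?_
        simp [hχ5 x hx]
      · have := hw.deriv_nonneg (ℓ x)
        have := hN0 x
        change 0 ≤ deriv q (ℓ x) * Real.exp (2 * φ (ℓ x)) * χ R x ^ 2 * (a x ^ 2 + b x ^ 2)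
        positivity
    refine hLHS.trans (key.trans ?_)
    calc B / R ^ 2 * ((lam + 9) * (∫ x, Real.exp (2 * φ (ℓ x)) * χ (2 * R) x *
          (a x ^ 2 + b x ^ 2)) + 36 * ∫ x, Real.exp (2 * φ (ℓ x)) * χ (2 * R) x *
          (∑ i, a₁ i x ^ 2 + ∑ i, b₁ i x ^ 2))
        ≤ B / R ^ 2 * ((lam + 9) * (M * (2 * (2 * R))) + 36 * (B₂ * (M * (2 * (2 * R))))) := by
          gcongr
      _ = _ := by
          field_simp
          ring
  -- letting `R → ∞`
  have hzero : ∀ k : ℕ, ∀ᵐ x, x ∈ Metric.closedBall (0 : E) k → a x = 0 ∧ b x = 0 := by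
    intro k
    have hcb : IsCompact (Metric.closedBall (0 : E) (k : ℝ)) := isCompact_closedBall _ _
    have hnn : ∀ x, 0 ≤ deriv q (ℓ x) * Real.exp (2 * φ (ℓ x)) * (a x ^ 2 + b x ^ 2) := fun x =>
      mul_nonneg (mul_nonneg (hw.deriv_nonneg _) (Real.exp_nonneg _)) (hN0 x)
    have hio : ∀ R : ℝ, IntegrableOn (fun x => deriv q (ℓ x) * Real.exp (2 * φ (ℓ x)) *
        (a x ^ 2 + b x ^ 2)) (Metric.closedBall (0 : E) R) volume := fun R =>
      (locallyIntegrable_iff.1 l0 _ (isCompact_closedBall _ _)).continuousOn_mul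
        hm.continuousOn (isCompact_closedBall _ _)
    have hlim : Tendsto (fun R : ℝ => 4 * B * M * ((lam + 9) + 36 * B₂) / R) atTop (𝓝 0) :=
      tendsto_const_nhds.div_atTop tendsto_id
    have hle0 : ∫ x in Metric.closedBall (0 : E) k,
        deriv q (ℓ x) * Real.exp (2 * φ (ℓ x)) * (a x ^ 2 + b x ^ 2) ≤ 0 := by
      refine ge_of_tendsto hlim ?_
      filter_upwards [eventually_ge_atTop (max 1 (k : ℝ))] with R hR
      exact (setIntegral_mono_set (hio R) (Eventually.of_forall hnn)
        (Metric.closedBall_subset_closedBall ((le_max_right _ _).trans hR)).eventuallyLE).trans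
        (hcarl R ((le_max_left _ _).trans hR))
    have h0 := le_antisymm hle0 (integral_nonneg hnn)
    rw [setIntegral_eq_zero_iff_of_nonneg_ae (Eventually.of_forall hnn) (hio k)] at h0
    have h1 := (ae_restrict_iff' hcb.measurableSet).1 h0
    filter_upwards [h1] with x hx hxk
    have h2 := hx hxk
    have h3 : 0 < deriv q (ℓ x) * Real.exp (2 * φ (ℓ x)) := mul_pos (hpos _) (Real.exp_pos _)
    have h4 : a x ^ 2 + b x ^ 2 = 0 := (mul_eq_zero.1 h2).resolve_left h3.ne'
    constructor <;> nlinarith [sq_nonneg (a x), sq_nonneg (b x)]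
  filter_upwards [ae_all_iff.2 hzero] with x hx
  obtain ⟨k, hk⟩ := exists_nat_ge ‖x‖
  exact hx k (by simpa using hk)

end Vanishing

/-! ### Construction of the weight from the decay rate. -/

section Weight

/-- The function `(1 + r²) ^ (-σ)`. -/
def bracket (σ r : ℝ) : ℝ := (1 + r ^ 2) ^ (-σ)

theorem bracket_pos (σ r : ℝ) : 0 < bracket σ r := Real.rpow_pos_of_pos (by positivity) _

theorem bracket_add_one (σ r : ℝ) : (1 + r ^ 2) * bracket (σ + 1) r = bracket σ r := by
  have h : (0 : ℝ) < 1 + r ^ 2 := by positivity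
  unfold bracket
  rw [show -σ = -(σ + 1) + 1 by ring, Real.rpow_add_one h.ne', mul_comm]

theorem contDiff_bracket (σ : ℝ) : ContDiff ℝ ∞ (bracket σ) :=
  ContDiff.rpow_const_of_ne (by fun_prop) fun r => by positivity

theorem hasDerivAt_bracket (σ r : ℝ) :
    HasDerivAt (bracket σ) (-(2 * σ) * (r * bracket (σ + 1) r)) r := by
  have h1 : HasDerivAt (fun r : ℝ => 1 + r ^ 2) (2 * r) r := by
    simpa using (hasDerivAt_pow 2 r).const_add 1
  have h2 := h1.rpow_const (p := -σ) (Or.inl (by positivity))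
  convert! h2 using 1
  unfold bracket
  rw [show -σ - 1 = -(σ + 1) by ring]
  ring

theorem bracket_le_one {σ : ℝ} (hσ : 0 ≤ σ) (r : ℝ) : bracket σ r ≤ 1 :=
  Real.rpow_le_one_of_one_le_of_nonpos (by nlinarith [sq_nonneg r]) (by linarith)

/-- Two derivatives of `(1 + r²)^(-σ)` do not worsen its decay: the powers of `r` they produce are
compensated by the higher exponents, through `bracket_add_one`. As `q' = bracket σ`, this is the
comparison of `q'''` with `q'` required of a Carleman weight. -/
theorem abs_deriv_deriv_bracket_le {σ : ℝ} (hσ : 0 ≤ σ) (r : ℝ) :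
    |deriv (deriv (bracket σ)) r| ≤ (2 * σ + 4 * σ * (σ + 1)) * bracket σ r := by
  have h1 : deriv (bracket σ) = fun r => -(2 * σ) * (r * bracket (σ + 1) r) :=
    funext fun r => (hasDerivAt_bracket σ r).deriv
  have h2 := (((hasDerivAt_id' r).mul (hasDerivAt_bracket (σ + 1) r)).const_mul (-(2 * σ))).deriv
  have h3 : deriv (deriv (bracket σ)) r = -(2 * σ) * bracket (σ + 1) r +
      4 * σ * (σ + 1) * (r ^ 2 * bracket (σ + 1 + 1) r) := by
    rw [h1]
    refine Eq.trans h2 ?_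
    ring
  have b0 := bracket_pos σ r
  have b1 := bracket_pos (σ + 1) r
  have b2 := bracket_pos (σ + 1 + 1) r
  have e1 := bracket_add_one σ r
  have e2 := bracket_add_one (σ + 1) r
  have l1 : bracket (σ + 1) r ≤ bracket σ r := by nlinarith [mul_nonneg (sq_nonneg r) b1.le]
  have l2 : r ^ 2 * bracket (σ + 1 + 1) r ≤ bracket σ r := by nlinarith
  have l3 : 0 ≤ r ^ 2 * bracket (σ + 1 + 1) r := by positivity
  have m1 : 2 * σ * bracket (σ + 1) r ≤ 2 * σ * bracket σ r := by gcongr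
  have m2 : 4 * σ * (σ + 1) * (r ^ 2 * bracket (σ + 1 + 1) r) ≤ 4 * σ * (σ + 1) * bracket σ r := by
    gcongr
  have m3 : 0 ≤ 2 * σ * bracket (σ + 1) r := by positivity
  have m4 : 0 ≤ 4 * σ * (σ + 1) * (r ^ 2 * bracket (σ + 1 + 1) r) := by positivity
  rw [h3, abs_le]
  constructor <;> linarith

/-- Decay like `|r|^(-2σ)` is integrable on the line exactly above this threshold; with `σ = 2ρ` it
is the condition `ρ > 1/4`. -/
theorem integrable_bracket {σ : ℝ} (hσ : 1 / 2 < σ) : Integrable (bracket σ) volume := by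
  have h := integrable_rpow_neg_one_add_norm_sq (E := ℝ) (μ := volume) (r := 2 * σ)
    (by simp; linarith)
  refine h.congr (Eventually.of_forall fun r => ?_)
  simp [bracket]
  congr 1
  ring

/-- The mass of `bracket σ`. -/
def bracketMass (σ : ℝ) : ℝ := ∫ r, bracket σ r

theorem bracketMass_nonneg (σ : ℝ) : 0 ≤ bracketMass σ :=
  integral_nonneg fun r => (bracket_pos σ r).le

/-- A bounded increasing function with derivative `bracket σ`. -/
def weightSlope (σ r : ℝ) : ℝ := 1 + bracketMass σ + ∫ s in (0 : ℝ)..r, bracket σ s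

theorem hasDerivAt_weightSlope (σ r : ℝ) : HasDerivAt (weightSlope σ) (bracket σ r) r := by
  have hc := (contDiff_bracket σ).continuous
  exact (intervalIntegral.integral_hasDerivAt_right (hc.intervalIntegrable _ _)
    (hc.stronglyMeasurableAtFilter _ _) hc.continuousAt).const_add _

theorem deriv_weightSlope (σ : ℝ) : deriv (weightSlope σ) = bracket σ :=
  funext fun r => (hasDerivAt_weightSlope σ r).deriv

theorem contDiff_weightSlope (σ : ℝ) : ContDiff ℝ ∞ (weightSlope σ) := by
  rw [contDiff_infty_iff_deriv, deriv_weightSlope]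
  exact ⟨fun r => (hasDerivAt_weightSlope σ r).differentiableAt, contDiff_bracket σ⟩

theorem abs_integral_bracket_le {σ : ℝ} (hσ : 1 / 2 < σ) (r : ℝ) :
    |∫ s in (0 : ℝ)..r, bracket σ s| ≤ bracketMass σ := by
  have h := intervalIntegral.norm_integral_le_integral_norm_uIoc (f := bracket σ) (a := 0) (b := r)
    (μ := volume)
  refine h.trans ?_
  have hn : ∀ s, ‖bracket σ s‖ = bracket σ s := fun s =>
    Real.norm_of_nonneg (bracket_pos σ s).le
  simp_rw [hn]
  exact setIntegral_le_integral (integrable_bracket hσ)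
    (Eventually.of_forall fun s => (bracket_pos σ s).le)

/-- For negative `r` the integral in `weightSlope` is negative, but at least `-bracketMass σ`; the
additive constant `1 + bracketMass σ` compensates for it. -/
theorem one_le_weightSlope {σ : ℝ} (hσ : 1 / 2 < σ) (r : ℝ) : 1 ≤ weightSlope σ r := by
  have := neg_abs_le (∫ s in (0 : ℝ)..r, bracket σ s)
  have := abs_integral_bracket_le hσ r
  unfold weightSlope
  linarith

theorem weightSlope_le {σ : ℝ} (hσ : 1 / 2 < σ) (r : ℝ) :
    weightSlope σ r ≤ 1 + 2 * bracketMass σ := by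
  have := le_abs_self (∫ s in (0 : ℝ)..r, bracket σ s)
  have := abs_integral_bracket_le hσ r
  unfold weightSlope
  linarith

/-- The exponent of the Carleman weight, with derivative `lam * weightSlope σ`. -/
def weightExponent (σ lam r : ℝ) : ℝ := lam * ∫ s in (0 : ℝ)..r, weightSlope σ s

theorem hasDerivAt_weightExponent (σ lam r : ℝ) :
    HasDerivAt (weightExponent σ lam) (lam * weightSlope σ r) r := by
  have hc := (contDiff_weightSlope σ).continuous
  exact (intervalIntegral.integral_hasDerivAt_right (hc.intervalIntegrable _ _)
    (hc.stronglyMeasurableAtFilter _ _) hc.continuousAt).const_mul _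

theorem weightExponent_le {σ lam : ℝ} (hσ : 1 / 2 < σ) (hlam : 0 ≤ lam) (r : ℝ) :
    weightExponent σ lam r ≤ lam * ((1 + 2 * bracketMass σ) * |r|) := by
  have h : ‖∫ s in (0 : ℝ)..r, weightSlope σ s‖ ≤ (1 + 2 * bracketMass σ) * |r - 0| := by
    refine intervalIntegral.norm_integral_le_of_norm_le_const fun s _ => ?_
    rw [Real.norm_of_nonneg (by linarith [one_le_weightSlope hσ s])]
    exact weightSlope_le hσ s
  rw [sub_zero] at h
  unfold weightExponent
  gcongr
  exact (le_abs_self _).trans h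

theorem isCarlemanWeight_weightExponent {σ lam : ℝ} (hσ : 1 / 2 < σ)
    (hlam : 1 + 2 * (2 * σ + 4 * σ * (σ + 1)) ≤ lam) :
    IsCarlemanWeight (weightExponent σ lam) (weightSlope σ) lam
      (2 * σ + 4 * σ * (σ + 1)) where
  contDiff := by
    rw [contDiff_infty_iff_deriv,
      show deriv (weightExponent σ lam) = fun r => lam * weightSlope σ r from
        funext fun r => (hasDerivAt_weightExponent σ lam r).deriv]
    exact ⟨fun r => (hasDerivAt_weightExponent σ lam r).differentiableAt,
      contDiff_const.mul (contDiff_weightSlope σ)⟩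
  contDiff_slope := contDiff_weightSlope σ
  deriv_eq r := (hasDerivAt_weightExponent σ lam r).deriv
  one_le := one_le_weightSlope hσ
  deriv_nonneg r := by
    rw [deriv_weightSlope]
    exact (bracket_pos σ r).le
  deriv_le_one r := by
    rw [deriv_weightSlope]
    exact bracket_le_one (by linarith) r
  abs_deriv_le r := by
    rw [deriv_weightSlope]
    exact abs_deriv_deriv_bracket_le (by linarith) r
  nonneg := by positivity
  le_lam := hlam

end Weight

/-! ### Uniqueness of weak derivatives. -/

section WeakDerivatives

variable {E : Type*} [NormedAddCommGroup E] [NormedSpace ℝ E] [FiniteDimensional ℝ E]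
  [MeasureSpace E] [BorelSpace E]

/-- By the fundamental lemma of the calculus of variations. It identifies the derivative chosen in
`weakDeriv` with the one supplied by `MemHloc`, so that local square integrability transfers. -/
theorem HasWeakDeriv.ae_eq {v : E} {f g g' : E → ℂ} (h : HasWeakDeriv v f g)
    (h' : HasWeakDeriv v f g') : g =ᵐ[volume] g' :=
  ae_eq_of_integral_contDiff_smul_eq h.locallyIntegrable_deriv h'.locallyIntegrable_deriv
    fun φ hφ hc => neg_injective <|
      (h.integral_eq φ hφ hc).symm.trans (h'.integral_eq φ hφ hc)

theorem HasWeakDeriv.hasWeakDeriv_weakDeriv {v : E} {f g : E → ℂ} (h : HasWeakDeriv v f g) :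
    HasWeakDeriv v f (weakDeriv v f) := by
  have hex : ∃ g, HasWeakDeriv v f g := ⟨g, h⟩
  rw [weakDeriv, dif_pos hex]
  exact hex.choose_spec

theorem MemL2loc.congr {f g : E → ℂ} (hf : MemL2loc f) (h : f =ᵐ[volume] g) : MemL2loc g :=
  fun K hK => (memLp_congr_ae (ae_restrict_of_ae h)).1 (hf K hK)

/-- The weak derivatives of order at most two of an `H²_loc` function. -/
theorem MemHloc.weakDeriv {u : E → ℂ} (hu : MemHloc 2 u) (v : E) :
    HasWeakDeriv v u (weakDeriv v u) ∧ MemL2loc (weakDeriv v u) ∧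
    HasWeakDeriv v (Waveguide.weakDeriv v u) (Waveguide.weakDeriv v (Waveguide.weakDeriv v u)) ∧
    MemL2loc (Waveguide.weakDeriv v (Waveguide.weakDeriv v u)) := by
  obtain ⟨g, hg, hg2, hgd⟩ := hu.2 v
  obtain ⟨k, hk, hk2⟩ := hgd v
  have h1 := hg.hasWeakDeriv_weakDeriv
  have h2 := hg.ae_eq h1
  have h3 : HasWeakDeriv v (Waveguide.weakDeriv v u) k := hk.congr h2.symm .rfl
  have h4 := h3.hasWeakDeriv_weakDeriv
  exact ⟨h1, hg2.congr h2, h4, MemL2loc.congr hk2 (h3.ae_eq h4)⟩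

end WeakDerivatives

/-! ### Specialization to space-time. -/

section SpaceTime

variable {n : ℕ}

instance : (volume : Measure (SpaceTime n)).IsAddHaarMeasure :=
  inferInstanceAs ((volume : Measure ℝ).prod (volume : Measure (Space n))).IsAddHaarMeasure

/-- The coordinate directions of space-time; `none` is the time direction. -/
def dir : Option (Fin n) → SpaceTime n
  | none => dirT n
  | some j => dirX j

/-- The coordinate `x_j` on space-time. -/
def coordX (j : Fin n) : SpaceTime n →L[ℝ] ℝ :=
  (EuclideanSpace.proj j).comp (ContinuousLinearMap.snd ℝ ℝ (Space n))

theorem coordX_apply (j : Fin n) (z : SpaceTime n) : coordX j z = z.2 j := rfl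

theorem coordX_dir (j : Fin n) (i : Option (Fin n)) :
    coordX j (dir i) = if i = some j then 1 else 0 := by
  cases i with
  | none => simp [coordX_apply, dir, dirT]
  | some k => simp [coordX_apply, dir, dirX, eq_comm]

theorem abs_coordX_le (j : Fin n) (z : SpaceTime n) : |coordX j z| ≤ ‖z.2‖ :=
  PiLp.norm_apply_le z.2 j

theorem laplaceTX_eq (u : SpaceTime n → ℂ) (z : SpaceTime n) :
    laplaceTX u z = ∑ i, weakDeriv (dir i) (weakDeriv (dir i) u) z := by
  rw [Fintype.sum_option]
  rfl

/-- Cauchy–Schwarz, once the time and space components are indexed together by `Option (Fin n)`. -/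
theorem norm_firstOrder_le (W : SpaceTime n → Covec n) (u : SpaceTime n → ℂ) (z : SpaceTime n) :
    ‖firstOrder W u z‖ ≤ ‖W z‖ * √(∑ i, ‖weakDeriv (dir i) u z‖ ^ 2) := by
  let w : Option (Fin n) → ℂ := fun i => i.elim (W z).fst fun j => (W z).snd j
  have h1 : firstOrder W u z = ∑ i, w i * weakDeriv (dir i) u z := by
    rw [Fintype.sum_option]
    rfl
  have h2 : ‖W z‖ = √(∑ i, ‖w i‖ ^ 2) := by
    rw [Fintype.sum_option, WithLp.prod_norm_eq_of_L2, EuclideanSpace.norm_sq_eq]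
    rfl
  rw [h1, h2]
  refine (norm_sum_le _ _).trans ?_
  simp_rw [norm_mul]
  exact Real.sum_mul_le_sqrt_mul_sqrt _ _ _

/-- The differential inequality in squared form. -/
theorem norm_sq_laplaceTX_le {C ρ : ℝ} (hρ : 0 ≤ ρ) (j : Fin n) {v : ℂ}
    {W : SpaceTime n → Covec n} {u : SpaceTime n → ℂ} {z : SpaceTime n}
    (hV : ‖v‖ ≤ C / (1 + ‖z.2‖ ^ 2) ^ ρ) (hW : ‖W z‖ ≤ C / (1 + ‖z.2‖ ^ 2) ^ ρ)
    (h : ‖laplaceTX u z‖ ≤ ‖v * u z‖ + ‖firstOrder W u z‖) :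
    ‖laplaceTX u z‖ ^ 2 ≤ 2 * C ^ 2 * bracket (2 * ρ) (coordX j z) *
      (‖u z‖ ^ 2 + ∑ i, ‖weakDeriv (dir i) u z‖ ^ 2) := by
  set S := ∑ i, ‖weakDeriv (dir i) u z‖ ^ 2
  have hS : 0 ≤ S := Finset.sum_nonneg fun i _ => sq_nonneg _
  have hb : (0 : ℝ) < 1 + ‖z.2‖ ^ 2 := by positivity
  set m := ((1 + ‖z.2‖ ^ 2) ^ ρ)⁻¹
  have hm0 : 0 ≤ m := by positivity
  -- Decay in `|x|` is weakened to decay in one coordinate, since `|x_j| ≤ |x|` and the power is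
  -- decreasing. Squaring the potentials doubles the exponent `ρ`, which is why the weight is built
  -- with `σ = 2ρ`.
  have hm2 : m ^ 2 ≤ bracket (2 * ρ) (coordX j z) := by
    have h1 : m ^ 2 = (1 + ‖z.2‖ ^ 2) ^ (-(2 * ρ)) := by
      simp only [m]
      rw [← Real.rpow_neg hb.le, ← Real.rpow_natCast, ← Real.rpow_mul hb.le]
      congr 1
      push_cast
      ring
    rw [h1]
    refine Real.rpow_le_rpow_of_nonpos (by positivity) ?_ (by linarith)
    have := abs_coordX_le j z
    have : coordX j z ^ 2 ≤ ‖z.2‖ ^ 2 := sq_le_sq' (by linarith [neg_abs_le (coordX j z)])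
      ((le_abs_self _).trans this)
    linarith
  rw [div_eq_mul_inv] at hV hW
  have h1 : ‖laplaceTX u z‖ ≤ C * m * (‖u z‖ + √S) := by
    refine h.trans ?_
    rw [norm_mul, mul_add]
    refine add_le_add (by gcongr) ((norm_firstOrder_le W u z).trans ?_)
    gcongr
  calc ‖laplaceTX u z‖ ^ 2 ≤ (C * m * (‖u z‖ + √S)) ^ 2 := by gcongr
    _ = C ^ 2 * m ^ 2 * (‖u z‖ + √S) ^ 2 := by ring
    _ ≤ C ^ 2 * m ^ 2 * (2 * (‖u z‖ ^ 2 + S)) := by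
        gcongr
        nlinarith [sq_nonneg (‖u z‖ - √S), Real.sq_sqrt hS]
    _ ≤ C ^ 2 * bracket (2 * ρ) (coordX j z) * (2 * (‖u z‖ ^ 2 + S)) := by gcongr
    _ = _ := by ring

/-- A bound on the weighted slices of `u` bounds the weighted mass of `u` on balls of space-time. -/
theorem setIntegral_closedBall_le {w : SpaceTime n → ℝ} (hw : Continuous w) (hw0 : ∀ z, 0 ≤ w z)
    {u : SpaceTime n → ℂ} (hu : AEStronglyMeasurable u volume) {lam : ℝ}
    (hle : ∀ z, w z ≤ Real.exp (4 * lam * ‖z.2‖))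
    (hfin : (⨆ t : ℝ, ∫⁻ x : Space n,
      ENNReal.ofReal (Real.exp (4 * lam * ‖x‖) * ‖u (t, x)‖ ^ 2)) < ⊤) {R : ℝ} (hR : 0 ≤ R) :
    ∫ z in Metric.closedBall (0 : SpaceTime n) R, w z * ‖u z‖ ^ 2 ≤
      2 * (⨆ t : ℝ, ∫⁻ x : Space n,
        ENNReal.ofReal (Real.exp (4 * lam * ‖x‖) * ‖u (t, x)‖ ^ 2)).toReal * R := by
  set S := ⨆ t : ℝ, ∫⁻ x : Space n, ENNReal.ofReal (Real.exp (4 * lam * ‖x‖) * ‖u (t, x)‖ ^ 2)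
  have hmeas : AEStronglyMeasurable (fun z => w z * ‖u z‖ ^ 2) volume :=
    hw.aestronglyMeasurable.mul (hu.norm.pow 2)
  have hmeas2 : AEMeasurable (fun z : SpaceTime n =>
      ENNReal.ofReal (Real.exp (4 * lam * ‖z.2‖) * ‖u z‖ ^ 2)) volume := by
    refine AEMeasurable.ennreal_ofReal (AEMeasurable.mul ?_ (hu.norm.aemeasurable.pow_const 2))
    exact Measurable.aemeasurable (by fun_prop)
  rw [integral_eq_lintegral_of_nonneg_ae (Eventually.of_forall fun z =>
    mul_nonneg (hw0 z) (sq_nonneg _)) hmeas.restrict]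
  refine ENNReal.toReal_le_of_le_ofReal (by positivity) ?_
  -- Only the time variable is restricted; each slice is integrated over all of space, so the ball
  -- contributes the length `2R` times the supremum.
  have hsub : Metric.closedBall (0 : SpaceTime n) R ⊆ Set.Icc (-R) R ×ˢ Set.univ := by
    intro z hz
    rw [mem_closedBall_zero_iff] at hz
    have h1 : |z.1| ≤ R := (norm_fst_le z).trans hz
    exact ⟨abs_le.1 h1, Set.mem_univ _⟩
  calc ∫⁻ z in Metric.closedBall (0 : SpaceTime n) R, ENNReal.ofReal (w z * ‖u z‖ ^ 2)
      ≤ ∫⁻ z in Set.Icc (-R) R ×ˢ Set.univ,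
          ENNReal.ofReal (Real.exp (4 * lam * ‖z.2‖) * ‖u z‖ ^ 2) := by
        refine lintegral_mono' (Measure.restrict_mono hsub le_rfl) fun z => ?_
        have := hle z
        gcongr
    _ = ∫⁻ t in Set.Icc (-R) R, ∫⁻ x : Space n,
          ENNReal.ofReal (Real.exp (4 * lam * ‖x‖) * ‖u (t, x)‖ ^ 2) := by
        rw [Measure.volume_eq_prod, ← Measure.prod_restrict, Measure.restrict_univ,
          lintegral_prod]
        rw [Measure.volume_eq_prod] at hmeas2
        exact hmeas2.mono_ac (Measure.restrict_le_self.absolutelyContinuous.prod .rfl)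
    _ ≤ ∫⁻ _ in Set.Icc (-R) R, S := lintegral_mono fun t =>
        le_iSup (fun t : ℝ => ∫⁻ x : Space n,
          ENNReal.ofReal (Real.exp (4 * lam * ‖x‖) * ‖u (t, x)‖ ^ 2)) t
    _ = ENNReal.ofReal (2 * S.toReal * R) := by
        rw [setLIntegral_const, Real.volume_Icc, show R - -R = 2 * R by ring,
          show 2 * S.toReal * R = S.toReal * (2 * R) by ring,
          ENNReal.ofReal_mul ENNReal.toReal_nonneg, ENNReal.ofReal_toReal hfin.ne]

/-- A `C¹(ℝ; H¹)` function that vanishes almost everywhere has vanishing slices. -/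
theorem IsC1H1.slice_ae_eq_zero {u : SpaceTime n → ℂ} (hu : IsC1H1 u) (h0 : u =ᵐ[volume] 0)
    (t : ℝ) : (fun x => u (t, x)) =ᵐ[volume] 0 := by
  obtain ⟨U, hU, hUu⟩ := hu
  let F : ℝ → L2 n := fun t => (U t).1.fst
  have hF : Continuous F := by
    have h1 : Continuous fun t => (U t).1 := continuous_subtype_val.comp hU.continuous
    exact (WithLp.prod_continuous_ofLp 2 _ _).fst.comp h1
  have hae : F =ᵐ[volume] fun _ => (0 : L2 n) := by
    rw [Measure.volume_eq_prod] at h0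
    filter_upwards [Measure.ae_ae_of_ae_prod h0] with s hs
    refine Lp.ext ?_
    filter_upwards [hs, hUu s, Lp.coeFn_zero ℂ 2 (volume : Measure (Space n))] with x h1 h2 h3
    rw [h3]
    exact h2.symm.trans h1
  -- Fubini gives vanishing for almost every `t`; continuity in `L²` upgrades this to every `t`.
  have hz : F = fun _ => (0 : L2 n) := (hF.ae_eq_iff_eq volume continuous_const).1 hae
  have ht : F t = 0 := congrFun hz t
  refine (hUu t).trans ?_
  change ((F t : L2 n) : Space n → ℂ) =ᵐ[volume] 0
  rw [ht]
  exact Lp.coeFn_zero ℂ 2 _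

end SpaceTime

end Waveguide

end

/-! ### Choice of parameters and conclusion. -/

open Waveguide in
theorem theorem1 (n : ℕ) (hn : 1 ≤ n) (ρ : ℝ) (hρ : 1 / 4 < ρ) (C : ℝ) (hC : 0 < C) :
    ∃ lam₀ : ℝ,
      ∀ (V : SpaceTime n → ℂ) (W : SpaceTime n → Covec n),
        MemLp V ⊤ volume →
        (∀ᵐ z : SpaceTime n, ‖V z‖ ≤ C / (1 + ‖z.2‖ ^ 2) ^ ρ) →
        MemLp W ⊤ volume →
        (∀ᵐ z : SpaceTime n, ‖W z‖ ≤ C / (1 + ‖z.2‖ ^ 2) ^ ρ) →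
        ∀ u : SpaceTime n → ℂ,
          IsC1H1 u → MemHloc 2 u →
          (∀ᵐ z : SpaceTime n, ‖laplaceTX u z‖ ≤ ‖V z * u z‖ + ‖firstOrder W u z‖) →
          ∀ lam : ℝ, lam₀ < lam →
            (⨆ t : ℝ, ∫⁻ x : Space n,
              ENNReal.ofReal (Real.exp (4 * lam * ‖x‖) * ‖u (t, x)‖ ^ 2)) < ⊤ →
            u =ᵐ[volume] 0 ∧ ∀ t : ℝ, (fun x => u (t, x)) =ᵐ[volume] 0 := by
  have hσ : 1 / 2 < 2 * ρ := by linarith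
  set K := 2 * (2 * ρ) + 4 * (2 * ρ) * (2 * ρ + 1) with hK
  set Q := 1 + 2 * bracketMass (2 * ρ) with hQ
  have hQ1 : 1 ≤ Q := by linarith [bracketMass_nonneg (2 * ρ)]
  have hK0 : 0 ≤ K := by positivity
  -- The Carleman parameter will be `μ = 2λ / Q`, so that `2 μ Q = 4λ` matches the decay hypothesis.
  -- The threshold says that `μ` exceeds both the bound making the weight admissible and the bound
  -- allowing absorption of `V` and `W`.
  refine ⟨Q / 2 * max (1 + 2 * K) (36 * C ^ 2 + 1), ?_⟩
  intro V W _ hV _ hW u hu hu2 hineq lam hlam hfin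
  suffices h0 : u =ᵐ[volume] 0 from ⟨h0, hu.slice_ae_eq_zero h0⟩
  -- Any space coordinate will do for the weight; `n ≥ 1` provides one.
  let j : Fin n := ⟨0, hn⟩
  -- the Carleman parameter
  set μ := 2 * lam / Q with hμ
  have hμmax : max (1 + 2 * K) (36 * C ^ 2 + 1) ≤ μ := by
    rw [hμ, le_div_iff₀ (by linarith)]
    linarith
  have hμK : 1 + 2 * K ≤ μ := (le_max_left _ _).trans hμmax
  have hμC : 36 * C ^ 2 + 1 ≤ μ := (le_max_right _ _).trans hμmax
  have hμ0 : 0 ≤ μ := by linarith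
  have hμQ : μ * Q = 2 * lam := div_mul_cancel₀ _ (by linarith)
  have hlam0 : 0 ≤ lam := by nlinarith
  have hw := isCarlemanWeight_weightExponent hσ hμK
  have hd := fun i => hu2.weakDeriv (dir i)
  have hli : LocallyIntegrable u volume := (hd none).1.locallyIntegrable
  have hlim : ∀ L : ℂ →L[ℝ] ℝ, IsH2Limit dir (fun z => L (u z))
      (fun i z => L (weakDeriv (dir i) u z))
      (fun i z => L (weakDeriv (dir i) (weakDeriv (dir i) u) z)) := fun L =>
    isH2Limit_of_hasWeakDeriv hu2.1 (fun i => (hd i).2.1) (fun i => (hd i).2.2.2)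
      (fun i => (hd i).1) (fun i => (hd i).2.2.1) hli L
  have hsq : ∀ w : ℂ, Complex.reCLM w ^ 2 + Complex.imCLM w ^ 2 = ‖w‖ ^ 2 := fun w => by
    rw [← Complex.normSq_eq_norm_sq, Complex.normSq_apply, Complex.reCLM_apply,
      Complex.imCLM_apply]
    ring
  -- The Carleman inequality is for real functions, but the differential inequality couples the real
  -- and imaginary parts of `u`, so both enter together, and only the sums of their squares matter.
  have hzero := ae_eq_zero_of_carleman (i₀ := some j) (ℓ := coordX j) (hlim Complex.reCLM)
    (hlim Complex.imCLM) (coordX_dir j) hw hC hμC (Q := Q)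
    (M := 2 * (⨆ t : ℝ, ∫⁻ x : Space n,
        ENNReal.ofReal (Real.exp (4 * lam * ‖x‖) * ‖u (t, x)‖ ^ 2)).toReal) ?_ ?_ ?_ ?_
  · filter_upwards [hzero] with z hz
    exact Complex.ext hz.1 hz.2
  · filter_upwards [hV, hW, hineq] with z h1 h2 h3
    rw [← map_sum, ← map_sum, ← Finset.sum_add_distrib, hsq, hsq, ← laplaceTX_eq,
      deriv_weightSlope]
    simp_rw [hsq]
    exact norm_sq_laplaceTX_le (by linarith) j h1 h2 h3
  · intro r
    rw [deriv_weightSlope]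
    exact bracket_pos _ _
  · exact weightSlope_le hσ
  · intro R hR
    simp_rw [hsq]
    refine setIntegral_closedBall_le ?_ (fun z => Real.exp_nonneg _) hli.aestronglyMeasurable
      (fun z => ?_) hfin (by linarith)
    · have := hw.contDiff.continuous
      fun_prop
    · refine Real.exp_le_exp.2 ?_
      have h1 := weightExponent_le hσ hμ0 (coordX j z)
      have h2 := abs_coordX_le j z
      calc 2 * weightExponent (2 * ρ) μ (coordX j z) ≤ 2 * (μ * (Q * |coordX j z|)) := by
            gcongr
        _ = 4 * lam * |coordX j z| := by
            rw [← mul_assoc μ, hμQ]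
            ring
        _ ≤ 4 * lam * ‖z.2‖ := by gcongr
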